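/- Notation. Let $\mathcal P(\mathbb Q)$ be the set of symbols $\pi_r(s)$ with $r\neq s$ in $\mathbb P^1(\mathbb Q)$, with the action $\gamma\pi_r(s)=\pi_{\gamma r}(\gamma s)$ of $G=\mathrm{GL}_2^+(\mathbb Q)$. Let $\Xi$ be the group of divisors on $\mathcal P(\mathbb Q)$ and $\Xi_0$ the subgroup of divisors of degree $0$; put $[Z,Z']=\{Z'\}-\{Z\}\in\Xi_0$, $\{\infty,0\}=[\pi_\infty(0),\pi_0(\infty)]$ and $[s,t]_\infty=[\pi_\infty(s),\pi_\infty(t)]$ for $s,t\in\mathbb Q$. For an integer $k\ge 2$ let $V_k(\mathbb C)$ be the space of homogeneous polynomials of degree $k-2$ in $x,y$ over $\mathbb C$, with the right action $(P|\gamma)(x,y)=\det(\gamma)^{k-2}P((x,y)\gamma^{-1})=P(dx-cy,-bx+ay)$ of $\gamma=\begin{pmatrix}a&b\\c&d\end{pmatrix}\in G$. Let $M_k$ be the space of all modular forms of weight $k$ for congruence subgroups of $\mathrm{SL}_2(\mathbb Z)$, with the right action $F|_k\gamma(z)=\det(\gamma)^{k-1}(cz+d)^{-k}F(\gamma z)$,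 and let $a_0(F)$ be the constant term of the Fourier expansion of $F$ at infinity. Let $G$ act on $\mathrm{Hom}(\Xi_0,V_k(\mathbb C))$ on the right by $(\Phi|\gamma)(D)=\Phi(\gamma D)|\gamma$. For $F\in M_k$, $\gamma\in G$ and $\tau$ in the upper half plane $\mathcal H$, put $$W(F)(\tau)=\int_{i\infty}^{\tau}(F(t)-a_0(F))(tx+y)^{k-2}\,dt+a_0(F)\int_0^\tau (tx+y)^{k-2}\,dt,$$ $$\mathcal C(F)(\gamma)=W(F)(\tau)-W(F|_k\gamma^{-1})(\gamma\tau)\,|\,\gamma .$$ Theorem. (A) Let $V$ be a $\mathbb Q$-vector space with a right action of $G$, $H$ a subgroup of $G$, $\mathcal D$ a system of representatives of $H\backslash\mathcal P(\mathbb Q)$, and $c:H\to V$ a cocycle, $c(\gamma\gamma')=c(\gamma)|\gamma'+c(\gamma')$, that vanishes on the stabilizer in $H$ of every element of $\mathcal D$. Then there is a homomorphism $\Psi:\Xi_0\to V$ with $\Psi(\gamma E)=\Psi(E)|\gamma^{-1}$ for all $\gamma\in H$, $E\in\Xi_0$, and with $\Psi([Z,\gamma^{-1}Z])=c(\gamma)$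 for all $\gamma\in H$ and $Z\in\mathcal D$. If $H$ acts transitively on $\mathcal P(\mathbb Q)$, then $\Psi$ is unique. (B) Let $k\ge2$. The integral defining $W(F)(\tau)$ converges absolutely for all $F\in M_k$ and $\tau\in\mathcal H$. There is a unique $G$-equivariant homomorphism $\mathcal Per:M_k\to\mathrm{Hom}(\Xi_0,V_k(\mathbb C))$ such that $$\mathcal Per(F)([\pi_\infty(0),\gamma^{-1}\pi_\infty(0)])=\mathcal C(F)(\gamma)$$ for all $F\in M_k$ and $\gamma\in G$, whatever the point $\tau\in\mathcal H$ used on the right-hand side; in particular $\mathcal C(F)(\gamma)$ does not depend on $\tau$. The map $\mathcal Per$ is $\mathbb C$-linear, and it is unique even among additive $G$-equivariant maps. It is also the unique additive $G$-equivariant map such that, for all $F\in M_k$ and $r\in\mathbb Q$, $$\mathcal Per(F)(\{\infty,0\})=\int_{i\infty}^0(F(t)-a_0(F))(tx+y)^{k-2}(-it)^s\,dt\Big|_{s=0},\qquad \mathcal Per(F)([0,r]_\infty)=a_0(F)\int_0^r(tx+y)^{k-2}\,dt .$$ Here the first right-hand side means: the integral converges absolutely for $\mathrm{Re}(s)\ge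 k$, it has a meromorphic continuation to $s\in\mathbb C$ that is holomorphic at $s=0$, and one takes its value at $s=0$. -/

import Mathlib

open scoped MatrixGroups ModularForm Manifold Pointwise
open UpperHalfPlane MeasureTheory

namespace PeriodHom

noncomputable section

/-- The group `GL₂⁺(ℚ)`. -/
abbrev G : Type := GL(2, ℚ)⁺

/-! ### Infinitesimal cusps and the groups `Ξ`, `Ξ₀` -/

/-- An infinitesimal cusp `π_r(s)`, where `r ≠ s` are points of `ℙ¹(ℚ) = ℚ ∪ {∞}`. -/
@[ext]
structure InfCusp where
  /-- the base point `r` -/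
  base : OnePoint ℚ
  /-- the direction `s` -/
  dir : OnePoint ℚ
  ne : base ≠ dir

/-- `γ π_r(s) = π_{γ r}(γ s)`, for the action by Möbius transformations on `ℙ¹(ℚ)`. -/
instance : MulAction G InfCusp where
  smul γ Z := ⟨γ • Z.base, γ • Z.dir, fun h => Z.ne (MulAction.injective γ h)⟩
  one_smul Z := InfCusp.ext (one_smul G Z.base) (one_smul G Z.dir)
  mul_smul γ δ Z := InfCusp.ext (mul_smul γ δ Z.base) (mul_smul γ δ Z.dir)

/-- The group `Ξ` of divisors on the set of infinitesimal cusps. -/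
abbrev Xi : Type := InfCusp →₀ ℤ

/-- The degree of a divisor. -/
def deg : Xi →+ ℤ := Finsupp.liftAddHom fun _ => AddMonoidHom.id ℤ

/-- The group `Ξ₀` of divisors of degree `0`. -/
def Xi0 : AddSubgroup Xi := deg.ker

/-- The left action of `GL₂⁺(ℚ)` on divisors. -/
def actXi (γ : G) : Xi →+ Xi := Finsupp.mapDomain.addMonoidHom fun Z => γ • Z

theorem deg_actXi (γ : G) (D : Xi) : deg (actXi γ D) = deg D := by
  have h : deg.comp (actXi γ) = deg := by
    ext Z
    simp [deg, actXi]
  exact DFunLike.congr_fun h D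

/-- The left action of `GL₂⁺(ℚ)` on `Ξ₀`. -/
instance : DistribMulAction G Xi0 where
  smul γ D := ⟨actXi γ D, by
    have h : deg (D : Xi) = 0 := D.2
    show deg _ = 0
    rw [deg_actXi, h]⟩
  one_smul D := by
    apply Subtype.ext
    show Finsupp.mapDomain _ _ = _
    simp only [one_smul]
    exact Finsupp.mapDomain_id
  mul_smul γ δ D := by
    apply Subtype.ext
    show Finsupp.mapDomain _ _ = Finsupp.mapDomain _ (Finsupp.mapDomain _ _)
    rw [← Finsupp.mapDomain_comp]
    congr 1
    ext Z : 1
    exact mul_smul γ δ Z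
  smul_zero γ := Subtype.ext ((actXi γ).map_zero)
  smul_add γ D E := Subtype.ext ((actXi γ).map_add D.1 E.1)

/-- The divisor `[Z, Z'] = {Z'} - {Z}` in `Ξ₀`. -/
def brk (Z Z' : InfCusp) : Xi0 :=
  ⟨Finsupp.single Z' 1 - Finsupp.single Z 1, by
    show deg _ = 0
    rw [map_sub]
    simp [deg]⟩

/-- The infinitesimal cusp `π_∞(s)` for `s ∈ ℚ`. -/
def piInfty (s : ℚ) : InfCusp := ⟨OnePoint.infty, (s : OnePoint ℚ), OnePoint.infty_ne_coe s⟩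

/-- The infinitesimal cusp `π_0(∞)`. -/
def piZero : InfCusp := ⟨((0 : ℚ) : OnePoint ℚ), OnePoint.infty, OnePoint.coe_ne_infty 0⟩

/-- The modular symbol `{∞, 0} = [π_∞(0), π_0(∞)]`. -/
def symInftyZero : Xi0 := brk (piInfty 0) piZero

/-- The infinitesimal symbol `[s, t]_∞ = [π_∞(s), π_∞(t)]` based at `∞`. -/
def symInf (s t : ℚ) : Xi0 := brk (piInfty s) (piInfty t)

/-! ### The space `V_k(ℂ)` -/

/-- `V_k(ℂ)`: homogeneous polynomials of degree `k - 2` in `x = X 0`, `y = X 1`. -/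
abbrev Vk (k : ℕ) : Type := MvPolynomial.homogeneousSubmodule (Fin 2) ℂ (k - 2)

/-- The linear forms `d x - c y`, `- b x + a y` that are substituted for `x`, `y`. -/
def substForms (γ : G) : Fin 2 → MvPolynomial (Fin 2) ℂ :=
  ![MvPolynomial.C ((γ.1 1 1 : ℚ) : ℂ) * MvPolynomial.X 0
      - MvPolynomial.C ((γ.1 1 0 : ℚ) : ℂ) * MvPolynomial.X 1,
    - MvPolynomial.C ((γ.1 0 1 : ℚ) : ℂ) * MvPolynomial.X 0
      + MvPolynomial.C ((γ.1 0 0 : ℚ) : ℂ) * MvPolynomial.X 1]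

theorem substForms_isHomogeneous (γ : G) (i : Fin 2) : (substForms γ i).IsHomogeneous 1 := by
  have h (c : ℂ) (j : Fin 2) :
      (MvPolynomial.C c * MvPolynomial.X j : MvPolynomial (Fin 2) ℂ).IsHomogeneous 1 :=
    MvPolynomial.isHomogeneous_C_mul_X c j
  fin_cases i
  · exact (h _ 0).sub (h _ 1)
  · simp only [substForms, ← MvPolynomial.C_neg]
    exact (h _ 0).add (h _ 1)

/-- The right action `(P|γ)(x, y) = det(γ)^{k-2} P((x, y) γ⁻¹) = P(d x - c y, - b x + a y)`. -/
def slashV {k : ℕ} (γ : G) : Vk k →ₗ[ℂ] Vk k :=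
  (MvPolynomial.aeval (substForms γ)).toLinearMap.restrict fun P hP => by
    have := MvPolynomial.IsHomogeneous.aeval (φ := P) hP (substForms γ)
      (substForms_isHomogeneous γ)
    simpa using this

theorem slashV_one {k : ℕ} (P : Vk k) : slashV 1 P = P := by
  apply Subtype.ext
  show MvPolynomial.aeval (substForms 1) P.1 = P.1
  have : substForms 1 = MvPolynomial.X := by
    ext1 i; fin_cases i <;> simp [substForms]
  rw [this, MvPolynomial.aeval_X_left]; rfl

theorem slashV_mul {k : ℕ} (γ δ : G) (P : Vk k) :
    slashV (γ * δ) P = slashV δ (slashV γ P) := by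
  apply Subtype.ext
  show MvPolynomial.aeval (substForms (γ * δ)) P.1 =
    MvPolynomial.aeval (substForms δ) (MvPolynomial.aeval (substForms γ) P.1)
  rw [← AlgHom.comp_apply, MvPolynomial.comp_aeval]
  congr 2
  have m (i j : Fin 2) : (((γ * δ).1 i j : ℚ) : ℂ) =
      ((γ.1 i 0 : ℚ) : ℂ) * ((δ.1 0 j : ℚ) : ℂ) + ((γ.1 i 1 : ℚ) : ℂ) * ((δ.1 1 j : ℚ) : ℂ) := by
    have : (γ * δ).1 i j = γ.1 i 0 * δ.1 0 j + γ.1 i 1 * δ.1 1 j := by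
      show (γ.1.1 * δ.1.1) i j = _
      rw [Matrix.mul_apply, Fin.sum_univ_two]
    rw [this]
    push_cast
    rfl
  ext1 i
  fin_cases i
  · simp only [substForms, m, Fin.zero_eta, Matrix.cons_val_zero, map_add, map_sub, map_mul,
      map_neg, MvPolynomial.aeval_X, MvPolynomial.aeval_C, MvPolynomial.algebraMap_eq,
      Matrix.cons_val_one]
    ring
  · simp only [substForms, m, Fin.mk_one, Matrix.cons_val_zero, map_add, map_sub, map_mul,
      map_neg, MvPolynomial.aeval_X, MvPolynomial.aeval_C, MvPolynomial.algebraMap_eq,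
      Matrix.cons_val_one]
    ring

/-- The vector `(t x + y)^{k-2}` of `V_k(ℂ)`. -/
def linPow (k : ℕ) (t : ℂ) : Vk k :=
  ⟨(MvPolynomial.C t * MvPolynomial.X 0 + MvPolynomial.X 1) ^ (k - 2), by
    have h := ((MvPolynomial.isHomogeneous_C_mul_X (R := ℂ) t (0 : Fin 2)).add
      (MvPolynomial.isHomogeneous_X ℂ (1 : Fin 2))).pow (k - 2)
    simpa using h⟩

/-- The exponent of the monomial `x ^ j * y ^ (k - 2 - j)`. -/
def expo (k j : ℕ) : Fin 2 →₀ ℕ := Finsupp.single 0 j + Finsupp.single 1 (k - 2 - j)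

/-- The coefficient of `x ^ j * y ^ (k - 2 - j)` in an element of `V_k(ℂ)`. -/
def coeffV {k : ℕ} (j : ℕ) (P : Vk k) : ℂ := MvPolynomial.coeff (expo k j) P.1

/-- The element `∑ a_j x ^ j * y ^ (k - 2 - j)` of `V_k(ℂ)`. -/
def ofCoeffs (k : ℕ) (a : ℕ → ℂ) : Vk k :=
  ∑ j : Fin (k - 2 + 1), ⟨MvPolynomial.monomial (expo k j) (a j),
    MvPolynomial.isHomogeneous_monomial _ (by
      have := j.2
      have e : (expo k j).degree = j + (k - 2 - j) := by
        rw [expo, map_add, Finsupp.degree_single, Finsupp.degree_single]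
      omega)⟩

/-! ### Path integrals of `V_k(ℂ)`-valued functions -/

/-- The integral over `S ⊆ ℝ` of a `V_k(ℂ)`-valued function, coefficient by coefficient. -/
def intV {k : ℕ} (S : Set ℝ) (f : ℝ → Vk k) : Vk k :=
  ofCoeffs k fun j => ∫ u in S, coeffV j (f u)

/-- `∫_z^{i∞} g(t) dt` along the vertical geodesic `t = z + i u`, `u > 0`. -/
def rayInt {k : ℕ} (g : ℂ → Vk k) (z : ℂ) : Vk k :=
  intV (Set.Ioi 0) fun u => Complex.I • g (z + Complex.I * u)

/-- Absolute convergence of `∫_z^{i∞} g(t) dt`. -/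
def RayIntegrable {k : ℕ} (g : ℂ → Vk k) (z : ℂ) : Prop :=
  ∀ j ≤ k - 2, IntegrableOn (fun u : ℝ => coeffV j (g (z + Complex.I * u))) (Set.Ioi 0)

/-- `∫_0^z (t x + y)^{k-2} dt`, along the segment `t = u z`, `0 < u < 1`. The integrand is
entire, so the path does not matter. -/
def linInt (k : ℕ) (z : ℂ) : Vk k :=
  intV (Set.Ioo 0 1) fun u => z • linPow k (u * z)

/-! ### Modular forms -/

/-- The embedding of `GL₂⁺(ℚ)` in `GL₂(ℝ)`. -/
def toGLR : G →* GL (Fin 2) ℝ :=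
  (Matrix.GeneralLinearGroup.map (Rat.castHom ℝ)).comp (Matrix.GLPos (Fin 2) ℚ).subtype

theorem det_toGLR_pos (γ : G) : 0 < (toGLR γ).det.val := by
  have h : (0 : ℚ) < (γ.1).det.val := γ.2
  have e : (toGLR γ).det.val = (((γ.1).det.val : ℚ) : ℝ) := by
    simp [toGLR, Matrix.GeneralLinearGroup.map_det]
  rw [e]
  exact_mod_cast h

/-- `F` is a modular form of weight `k` for some congruence subgroup of `SL₂(ℤ)`. -/
def IsCongForm (k : ℕ) (F : ℍ → ℂ) : Prop :=
  ∃ Γ : Subgroup SL(2, ℤ), CongruenceSubgroup.IsCongruenceSubgroup Γ ∧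
    ∃ f : ModularForm (Γ.map (Matrix.SpecialLinearGroup.mapGL ℝ)) (k : ℤ), ⇑f = F

theorem restrictForm {k : ℤ} {Γ Γ' : Subgroup (GL (Fin 2) ℝ)} (h : Γ' ≤ Γ)
    (f : ModularForm Γ k) : ∃ f' : ModularForm Γ' k, (⇑f' : ℍ → ℂ) = f :=
  ⟨{ toFun := f
     slash_action_eq' := fun A hA => f.slash_action_eq' A (h hA)
     holo' := f.holo'
     bdd_at_cusps' := fun hc => f.bdd_at_cusps' (hc.mono h) }, rfl⟩

theorem isCongruenceSubgroup_inf {Γ Γ' : Subgroup SL(2, ℤ)}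
    (h : CongruenceSubgroup.IsCongruenceSubgroup Γ)
    (h' : CongruenceSubgroup.IsCongruenceSubgroup Γ') :
    CongruenceSubgroup.IsCongruenceSubgroup (Γ ⊓ Γ') := by
  obtain ⟨N, hN, h⟩ := h
  obtain ⟨M, hM, h'⟩ := h'
  refine ⟨N * M, mul_ne_zero hN hM, le_inf ?_ ?_⟩
  · refine le_trans (fun γ hγ => ?_) h
    rw [CongruenceSubgroup.Gamma_mem] at hγ ⊢
    have key (a b : ℤ) (e : (a : ZMod (N * M)) = b) : (a : ZMod N) = b := by
      rw [ZMod.intCast_eq_intCast_iff_dvd_sub] at e ⊢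
      exact dvd_trans (by simp) e
    refine ⟨?_, ?_, ?_, ?_⟩
    · simpa using key _ 1 (by simpa using hγ.1)
    · simpa using key _ 0 (by simpa using hγ.2.1)
    · simpa using key _ 0 (by simpa using hγ.2.2.1)
    · simpa using key _ 1 (by simpa using hγ.2.2.2)
  · refine le_trans (fun γ hγ => ?_) h'
    rw [CongruenceSubgroup.Gamma_mem] at hγ ⊢
    have key (a b : ℤ) (e : (a : ZMod (N * M)) = b) : (a : ZMod M) = b := by
      rw [ZMod.intCast_eq_intCast_iff_dvd_sub] at e ⊢
      exact dvd_trans (by simp) e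
    refine ⟨?_, ?_, ?_, ?_⟩
    · simpa using key _ 1 (by simpa using hγ.1)
    · simpa using key _ 0 (by simpa using hγ.2.1)
    · simpa using key _ 0 (by simpa using hγ.2.2.1)
    · simpa using key _ 1 (by simpa using hγ.2.2.2)

/-- The space `M_k` of modular forms of weight `k` for congruence subgroups (of any level). -/
def Mk (k : ℕ) : Submodule ℂ (ℍ → ℂ) where
  carrier := {F | IsCongForm k F}
  zero_mem' := ⟨⊤, ⟨1, one_ne_zero, le_top⟩, 0, rfl⟩
  add_mem' := by
    rintro _ _ ⟨Γ, hΓ, f, rfl⟩ ⟨Γ', hΓ', f', rfl⟩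
    obtain ⟨g, hg⟩ := restrictForm (Subgroup.map_mono (f := Matrix.SpecialLinearGroup.mapGL ℝ)
      (inf_le_left : Γ ⊓ Γ' ≤ Γ)) f
    obtain ⟨g', hg'⟩ := restrictForm (Subgroup.map_mono (f := Matrix.SpecialLinearGroup.mapGL ℝ)
      (inf_le_right : Γ ⊓ Γ' ≤ Γ')) f'
    exact ⟨_, isCongruenceSubgroup_inf hΓ hΓ', g + g', by rw [← hg, ← hg']; rfl⟩
  smul_mem' := by
    rintro c _ ⟨Γ, hΓ, f, rfl⟩
    exact ⟨Γ, hΓ, c • f, rfl⟩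

theorem IsCongForm.slash {k : ℕ} {F : ℍ → ℂ} (hF : IsCongForm k F) (γ : G) :
    IsCongForm k (F ∣[(k : ℤ)] toGLR γ) := by
  obtain ⟨Γ, hΓ, f, rfl⟩ := hF
  refine ⟨_, hΓ.conjGL γ.1, ?_⟩
  have hle : (CongruenceSubgroup.conjGL Γ (γ.1.map (Rat.castHom ℝ))).map
      (Matrix.SpecialLinearGroup.mapGL ℝ) ≤
      ConjAct.toConjAct (toGLR γ)⁻¹ • Γ.map (Matrix.SpecialLinearGroup.mapGL ℝ) := by
    rintro _ ⟨x, hx, rfl⟩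
    obtain ⟨y, hy, e⟩ := CongruenceSubgroup.mem_conjGL.mp hx
    rw [Subgroup.mem_pointwise_smul_iff_inv_smul_mem]
    refine ⟨y, hy, ?_⟩
    simp only [← map_inv, inv_inv, ConjAct.toConjAct_smul]
    exact e
  obtain ⟨g, hg⟩ := restrictForm hle (ModularForm.translate f (toGLR γ))
  exact ⟨g, by rw [hg, ModularForm.coe_translate]⟩

/-- The right action `F|_k γ (z) = det(γ)^{k-1} (c z + d)^{-k} F(γ z)` of `GL₂⁺(ℚ)` on `M_k`. -/
def slashM {k : ℕ} (γ : G) : Mk k →ₗ[ℂ] Mk k where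
  toFun F := ⟨(F : ℍ → ℂ) ∣[(k : ℤ)] toGLR γ, IsCongForm.slash F.2 γ⟩
  map_add' F F' := Subtype.ext (SlashAction.add_slash _ _ _ _)
  map_smul' c F := Subtype.ext (by
    show (c • (F : ℍ → ℂ)) ∣[(k : ℤ)] toGLR γ = c • ((F : ℍ → ℂ) ∣[(k : ℤ)] toGLR γ)
    rw [ModularForm.smul_slash, UpperHalfPlane.σ, if_pos (det_toGLR_pos γ)]; rfl)

theorem slashM_apply {k : ℕ} (γ : G) (F : Mk k) (z : ℍ) :
    (slashM γ F : ℍ → ℂ) z =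
      (((γ.1).det.val : ℚ) : ℂ) ^ ((k : ℤ) - 1)
        * (((γ.1 1 0 : ℚ) : ℂ) * z + ((γ.1 1 1 : ℚ) : ℂ)) ^ (-(k : ℤ))
        * (F : ℍ → ℂ) (toGLR γ • z) := by
  show ((F : ℍ → ℂ) ∣[(k : ℤ)] toGLR γ) z = _
  rw [ModularForm.slash_apply, UpperHalfPlane.σ, if_pos (det_toGLR_pos γ),
    abs_of_pos (det_toGLR_pos γ)]
  have e : (toGLR γ).det.val = (((γ.1).det.val : ℚ) : ℝ) := by
    simp [toGLR, Matrix.GeneralLinearGroup.map_det]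
  have e1 : denom (toGLR γ) z = ((γ.1 1 0 : ℚ) : ℂ) * z + ((γ.1 1 1 : ℚ) : ℂ) := by
    simp [denom, toGLR]
  rw [e, e1]
  push_cast
  simp only [ContinuousAlgEquiv.refl_apply]
  ring

/-- The constant term `a₀(F)` of the Fourier expansion of `F` at infinity, that is, the value
of `F` at `i∞`. -/
def a0 (F : ℍ → ℂ) : ℂ := valueAtInfty F

/-- The function `t ↦ F(t) - a₀(F)` on the upper half plane, as a function of a complex variable. -/
def tildeF (F : ℍ → ℂ) (t : ℂ) : ℂ := F (ofComplex t) - a0 F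

/-- The Eichler integral
`W(F)(τ) = ∫_{i∞}^τ (F(t) - a₀(F)) (t x + y)^{k-2} dt + a₀(F) ∫_0^τ (t x + y)^{k-2} dt`. -/
def W (k : ℕ) (F : ℍ → ℂ) (τ : ℍ) : Vk k :=
  - rayInt (fun t => tildeF F t • linPow k t) τ + a0 F • linInt k τ

/-- The function `C(F)(γ) = W(F) - W(F|_k γ⁻¹)|γ` on the upper half plane, where
`(w|γ)(τ) = w(γ τ)|γ`. -/
def cocycleFun {k : ℕ} (F : Mk k) (γ : G) (τ : ℍ) : Vk k :=
  W k F τ - slashV γ (W k (slashM γ⁻¹ F) (toGLR γ • τ))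

/-- `v` is the regularized integral `∫_{i∞}^0 (F(t) - a₀(F)) (t x + y)^{k-2} (-i t)^s dt |_{s=0}`:
the integral converges absolutely for `Re s ≥ k`, and `v` is the value at `s = 0` of its
meromorphic continuation to `ℂ`, which is holomorphic at `0`. -/
def IsRegularizedPeriod {k : ℕ} (F : ℍ → ℂ) (v : Vk k) : Prop :=
  ∃ R : ℂ → Vk k,
    (∀ s : ℂ, (k : ℝ) ≤ s.re →
      RayIntegrable (fun t => (tildeF F t * (-Complex.I * t) ^ s) • linPow k t) 0 ∧
      R s = - rayInt (fun t => (tildeF F t * (-Complex.I * t) ^ s) • linPow k t) 0) ∧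
    (∀ j ≤ k - 2, MeromorphicOn (fun s => coeffV j (R s)) Set.univ ∧
      AnalyticAt ℂ (fun s => coeffV j (R s)) 0) ∧
    R 0 = v

/-- `P : M_k → Hom(Ξ₀, V_k(ℂ))` is a homomorphism of right `GL₂⁺(ℚ)`-modules, where
`(Φ|γ)(D) = Φ(γ D)|γ` for `Φ ∈ Hom(Ξ₀, V_k(ℂ))`. -/
def IsEquivariant {k : ℕ} (P : Mk k →+ (Xi0 →+ Vk k)) : Prop :=
  ∀ (γ : G) (F : Mk k) (D : Xi0), P (slashM γ F) D = slashV γ (P F (γ • D))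

/-- `P(F)([π_∞(0), γ⁻¹ π_∞(0)]) = C(F)(γ)` for all `F` and `γ`; in particular the function
`C(F)(γ)` on the upper half plane is constant. -/
def HasCocycleValues {k : ℕ} (P : Mk k →+ (Xi0 →+ Vk k)) : Prop :=
  ∀ (F : Mk k) (γ : G) (τ : ℍ), P F (brk (piInfty 0) (γ⁻¹ • piInfty 0)) = cocycleFun F γ τ

/-- `P(F)({∞, 0})` is the regularized integral of `(F(t) - a₀(F)) (t x + y)^{k-2}` from `i∞` to
`0`, and `P(F)([0, r]_∞) = a₀(F) ∫_0^r (t x + y)^{k-2} dt`. -/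
def HasPeriodValues {k : ℕ} (P : Mk k →+ (Xi0 →+ Vk k)) : Prop :=
  ∀ F : Mk k, IsRegularizedPeriod (F : ℍ → ℂ) (P F symInftyZero) ∧
    ∀ r : ℚ, P F (symInf 0 r) = a0 (F : ℍ → ℂ) • linInt k (r : ℂ)

/-! ### Cocycles of subgroups of `GL₂⁺(ℚ)` -/

/-- `c` is a `1`-cocycle of `H` with values in the right module `V`, where
`v|γ = MulOpposite.op γ • v`: `c(γ γ') = c(γ)|γ' + c(γ')`. -/
def IsCocycle {V : Type*} [AddCommGroup V] [DistribMulAction Gᵐᵒᵖ V] (H : Subgroup G)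
    (c : H → V) : Prop :=
  ∀ γ γ' : H, c (γ * γ') = MulOpposite.op (γ' : G) • c γ + c γ'

/-- `D` is a system of representatives of the orbits of `H` on the set of infinitesimal cusps. -/
def IsRepSystem (H : Subgroup G) (D : Set InfCusp) : Prop :=
  ∀ T : InfCusp, ∃! Z : InfCusp, Z ∈ D ∧ T ∈ MulAction.orbit H Z

/-- `Ψ` belongs to `Hom_H(Ξ₀, V)`: `Ψ(γ E) = Ψ(E)|γ⁻¹` for `γ ∈ H`. -/
def IsHInvariant {V : Type*} [AddCommGroup V] [DistribMulAction Gᵐᵒᵖ V] (H : Subgroup G)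
    (Ψ : Xi0 →+ V) : Prop :=
  ∀ (γ : H) (E : Xi0), Ψ ((γ : G) • E) = MulOpposite.op ((γ : G)⁻¹) • Ψ E

end

end PeriodHom

namespace PeriodHom

noncomputable section

open Filter Topology

/-! ### Homomorphisms on `Ξ₀` -/

/-! A divisor of degree 0 is a combination of symbols `[Z, T]` with `Z` fixed, so a homomorphism on
Ξ₀ is a function on infinitesimal cusps up to a constant. In (A), write each `T` as `δ⁻¹ Z` with `Z`
in the representative system and put `f(T) = c(δ)`. Vanishing of `c` on stabilizers makes this
independent of `δ`, and the cocycle relation makes the differences of `f` equivariant.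

For (B), G acts transitively on infinitesimal cusps, so everything is governed by the orbit of
`π_∞(0)`. The Eichler integral `W(F)` is a primitive of `F(t)(tx+y)^{k-2}`, and this differential
form is transported correctly by the actions of G. Hence `W(F)` and `W(F|γ⁻¹)|γ` have the same
derivative, and their difference is constant on the connected upper half plane (`cocycleFun_const`).
The cocycle relation is then formal. For upper triangular γ the rays to `i∞` correspond and their
contributions cancel, which leaves `a₀(F) ∫_0^{γ⁻¹0}` (`cocycleFun_borel`). It is zero on the
stabilizer of `π_∞(0)`, which consists of diagonal matrices, so the construction of (A) gives a
well-defined map, now with `F` varying along with γ.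

The value on `{∞, 0}` comes from the Weyl element. Its fixed point `i` cuts the imaginary axis at
the point where Riemann's splitting continues the Mellin transform of `F(iu) - a₀(F)`. Comparing
coefficients at `τ = i` identifies the cocycle with the continued Mellin transform at the integers
`1, ..., k-1`, away from its only possible poles `0` and `k` (`coeffV_cocycleFun_weyl`). For
uniqueness, G-translates of `{∞, 0}` and of the symbols `[0, r]_∞` connect all infinitesimal cusps
(`rel_of_edges`), and regularized values are unique by the identity theorem. -/

theorem brk_add_brk (A B C : InfCusp) : brk A B + brk B C = brk A C := by
  apply Subtype.ext
  show Finsupp.single B 1 - Finsupp.single A 1 + (Finsupp.single C 1 - Finsupp.single B 1) = _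
  simp [brk]

theorem smul_brk (γ : G) (A B : InfCusp) : γ • brk A B = brk (γ • A) (γ • B) := by
  apply Subtype.ext
  show actXi γ (Finsupp.single B 1 - Finsupp.single A 1) = _
  rw [map_sub]
  simp [brk, actXi]

/-- The divisor `D` is the sum of the symbols `[Z, T]` over the points `T` of `D`. -/
theorem liftAddHom_brk (Z : InfCusp) (D : Xi0) :
    Finsupp.liftAddHom (fun T => zmultiplesHom Xi0 (brk Z T)) (D : Xi) = D := by
  have key : (Xi0.subtype.comp (Finsupp.liftAddHom fun T => zmultiplesHom Xi0 (brk Z T))) =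
      AddMonoidHom.id Xi - ((zmultiplesHom Xi (Finsupp.single Z 1)).comp deg) := by
    ext1 T
    ext1
    simp [deg, brk]
  apply Subtype.ext
  have h := DFunLike.congr_fun key (D : Xi)
  have hD : deg (D : Xi) = 0 := D.2
  simpa [hD] using h

/-- Any base point `Z` works, since the terms in `{Z}` cancel in degree 0. -/
theorem hom_ext_of_brk {V : Type*} [AddCommGroup V] (Z : InfCusp) {Ψ Ψ' : Xi0 →+ V}
    (h : ∀ T, Ψ (brk Z T) = Ψ' (brk Z T)) : Ψ = Ψ' := by
  have key : Ψ.comp (Finsupp.liftAddHom fun T => zmultiplesHom Xi0 (brk Z T)) =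
      Ψ'.comp (Finsupp.liftAddHom fun T => zmultiplesHom Xi0 (brk Z T)) := by
    ext1 T
    ext1
    simpa using h T
  ext1 D
  rw [← liftAddHom_brk Z D]
  exact DFunLike.congr_fun key (D : Xi)

/-- The homomorphism `∑ n_T {T} ↦ ∑ n_T f(T)`. -/
def homOfFun {V : Type*} [AddCommGroup V] (f : InfCusp → V) : Xi0 →+ V :=
  (Finsupp.liftAddHom fun T => zmultiplesHom V (f T)).comp Xi0.subtype

theorem homOfFun_brk {V : Type*} [AddCommGroup V] (f : InfCusp → V) (A B : InfCusp) :
    homOfFun f (brk A B) = f B - f A := by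
  show Finsupp.liftAddHom (fun T => zmultiplesHom V (f T))
    (Finsupp.single B 1 - Finsupp.single A 1) = _
  rw [map_sub]
  simp

theorem exists_hom_of_cocycle {V : Type*} [AddCommGroup V] [DistribMulAction Gᵐᵒᵖ V]
    {H : Subgroup G} {D : Set InfCusp} {c : H → V} (hD : IsRepSystem H D) (hc : IsCocycle H c)
    (h0 : ∀ Z ∈ D, ∀ γ ∈ MulAction.stabilizer H Z, c γ = 0) :
    ∃ Ψ : Xi0 →+ V, IsHInvariant H Ψ ∧ ∀ (γ : H), ∀ Z ∈ D, Ψ (brk Z (γ⁻¹ • Z)) = c γ := by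
  have c1 : c 1 = 0 := by simpa using hc 1 1
  have ex (T : InfCusp) : ∃ p : InfCusp × H, p.1 ∈ D ∧ T = p.2⁻¹ • p.1 := by
    obtain ⟨Z, ⟨hZ, δ, hδ⟩, -⟩ := hD T
    exact ⟨(Z, δ⁻¹), hZ, by simpa using hδ.symm⟩
  choose p hp hpT using ex
  have hf (Z : InfCusp) (hZ : Z ∈ D) (γ : H) : c (p (γ⁻¹ • Z)).2 = c γ := by
    set T := γ⁻¹ • Z with hT
    have e : (p T).1 = Z := by
      obtain ⟨Z', -, hu⟩ := hD T
      rw [hu Z ⟨hZ, ⟨γ⁻¹, hT.symm⟩⟩, hu (p T).1 ⟨hp T, ⟨(p T).2⁻¹, (hpT T).symm⟩⟩]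
    -- Two elements carrying `T` back to `Z` differ by an element of the stabilizer, where `c`
    -- vanishes; the cocycle relation then gives them the same value.
    have hst : γ * (p T).2⁻¹ ∈ MulAction.stabilizer H Z := by
      rw [MulAction.mem_stabilizer_iff, mul_smul]
      nth_rewrite 1 [← e]
      rw [← hpT T, hT, smul_inv_smul]
    have := hc (γ * (p T).2⁻¹) (p T).2
    rw [h0 Z hZ _ hst] at this
    simpa using this.symm
  refine ⟨homOfFun fun T => c (p T).2, fun γ E => ?_, fun γ Z hZ => ?_⟩
  -- The summand `c γ⁻¹` does not depend on `T`, so it disappears in the differences that define the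
  -- homomorphism.
  · have act (T : InfCusp) : c (p ((γ : G) • T)).2 =
        MulOpposite.op ((γ : G)⁻¹) • c (p T).2 + c γ⁻¹ := by
      have h1 : (γ : G) • T = ((p T).2 * γ⁻¹)⁻¹ • (p T).1 := by
        rw [mul_inv_rev, inv_inv, mul_smul, ← hpT T]; rfl
      rw [h1, hf _ (hp T), hc]
      rfl
    have key : (homOfFun fun T => c (p T).2).comp (DistribSMul.toAddMonoidHom Xi0 (γ : G)) =
        (DistribSMul.toAddMonoidHom V (MulOpposite.op ((γ : G)⁻¹))).comp
          (homOfFun fun T => c (p T).2) := by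
      refine hom_ext_of_brk (piInfty 0) fun T => ?_
      simp only [AddMonoidHom.comp_apply, DistribSMul.toAddMonoidHom_apply, smul_brk,
        homOfFun_brk, act, smul_sub]
      abel
    exact DFunLike.congr_fun key E
  · have h1 := hf Z hZ 1
    rw [inv_one, one_smul] at h1
    rw [homOfFun_brk, hf Z hZ, h1, c1, sub_zero]

theorem hom_unique_of_transitive {V : Type*} [AddCommGroup V]
    {H : Subgroup G} {D : Set InfCusp} {c : H → V} (hD : IsRepSystem H D)
    [MulAction.IsPretransitive H InfCusp] {Ψ Ψ' : Xi0 →+ V}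
    (h : ∀ (γ : H), ∀ Z ∈ D, Ψ (brk Z (γ⁻¹ • Z)) = c γ)
    (h' : ∀ (γ : H), ∀ Z ∈ D, Ψ' (brk Z (γ⁻¹ • Z)) = c γ) : Ψ' = Ψ := by
  obtain ⟨Z, ⟨hZ, -⟩, -⟩ := hD (piInfty 0)
  refine hom_ext_of_brk Z fun T => ?_
  obtain ⟨γ, rfl⟩ := MulAction.exists_smul_eq H Z T
  rw [← inv_inv γ, h _ Z hZ, h' _ Z hZ]

/-! ### The action of `GL₂⁺(ℚ)` on infinitesimal cusps -/

/-- The matrix with rows `(a, b)` and `(c, d)`. -/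
def mkG (a b c d : ℚ) (h : 0 < a * d - b * c) : G :=
  ⟨Matrix.GeneralLinearGroup.mkOfDetNeZero !![a, b; c, d]
    (by rw [Matrix.det_fin_two_of]; exact h.ne'), by
    show 0 < Matrix.det !![a, b; c, d]
    rwa [Matrix.det_fin_two_of]⟩

section mkG

variable (a b c d : ℚ) (h : 0 < a * d - b * c)

@[simp] theorem mkG_00 : (mkG a b c d h).1 0 0 = a := rfl
@[simp] theorem mkG_01 : (mkG a b c d h).1 0 1 = b := rfl
@[simp] theorem mkG_10 : (mkG a b c d h).1 1 0 = c := rfl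
@[simp] theorem mkG_11 : (mkG a b c d h).1 1 1 = d := rfl

end mkG

theorem det_eq (γ : G) : (γ.1).det.val = γ.1 0 0 * γ.1 1 1 - γ.1 0 1 * γ.1 1 0 :=
  Matrix.det_fin_two _

theorem smul_infty (γ : G) : γ • (OnePoint.infty : OnePoint ℚ) =
    if γ.1 1 0 = 0 then OnePoint.infty else ((γ.1 0 0 / γ.1 1 0 : ℚ) : OnePoint ℚ) :=
  OnePoint.smul_infty_eq_ite γ.1

theorem smul_coe (γ : G) (t : ℚ) : γ • (t : OnePoint ℚ) =
    if γ.1 1 0 * t + γ.1 1 1 = 0 then OnePoint.infty else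
      (((γ.1 0 0 * t + γ.1 0 1) / (γ.1 1 0 * t + γ.1 1 1) : ℚ) : OnePoint ℚ) :=
  OnePoint.smul_some_eq_ite

theorem exists_smul_piInfty (T : InfCusp) : ∃ γ : G, γ • piInfty 0 = T := by
  obtain ⟨r, s, hrs⟩ := T
  induction r with
  | infty =>
    induction s with
    | infty => exact absurd rfl hrs
    | coe s =>
      refine ⟨mkG 1 s 0 1 (by norm_num), InfCusp.ext ?_ ?_⟩
      · exact (smul_infty _).trans (by simp)
      · exact (smul_coe _ 0).trans (by simp)
  | coe r =>
    induction s with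
    | infty =>
      refine ⟨mkG r (-1) 1 0 (by norm_num), InfCusp.ext ?_ ?_⟩
      · exact (smul_infty _).trans (by simp)
      · exact (smul_coe _ 0).trans (by simp)
    | coe s =>
      have h : r - s ≠ 0 := sub_ne_zero.mpr fun h => hrs (congrArg _ h)
      -- The columns represent `r` and `s`; scaling the second by `r - s` turns the determinant into
      -- a square, hence positive.
      refine ⟨mkG r ((r - s) * s) 1 (r - s) ?_, InfCusp.ext ?_ ?_⟩
      · have : r * (r - s) - (r - s) * s * 1 = (r - s) ^ 2 := by ring
        rw [this]; positivity
      · exact (smul_infty _).trans (by simp)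
      · exact (smul_coe _ 0).trans (by simp [h])

theorem exists_inv_smul_piInfty (T : InfCusp) : ∃ γ : G, γ⁻¹ • piInfty 0 = T := by
  obtain ⟨γ, h⟩ := exists_smul_piInfty T
  exact ⟨γ⁻¹, by rwa [inv_inv]⟩

/-- A `G`-stable equivalence relation on infinitesimal cusps that identifies `π_∞(0)` with
`π_0(∞)` and with `π_∞(s)` for all `s` identifies all of them. -/
theorem rel_of_edges {R : InfCusp → InfCusp → Prop}
    (trans : ∀ A B C, R A B → R B C → R A C) (act : ∀ (γ : G) A B, R A B → R (γ • A) (γ • B))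
    (h0 : R (piInfty 0) piZero) (h1 : ∀ s, R (piInfty 0) (piInfty s)) (T : InfCusp) :
    R (piInfty 0) T := by
  obtain ⟨r, s, hrs⟩ := T
  induction r with
  | infty =>
    induction s with
    | infty => exact absurd rfl hrs
    | coe s => exact h1 s
  | coe r =>
    -- The path is `π_∞(0)`, `π_∞(r)`, `π_r(∞) = B`, `π_r(s)`: change direction at infinity, cross
    -- to `r`, change direction at `r`.
    let B : InfCusp := ⟨(r : OnePoint ℚ), OnePoint.infty, OnePoint.coe_ne_infty r⟩
    have h2 : R (piInfty r) B := by
      have := act (mkG 1 r 0 1 (by norm_num)) _ _ h0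
      convert this using 1
      · refine InfCusp.ext ?_ ?_
        · exact Eq.symm ((smul_infty _).trans (by simp [piInfty]))
        · exact Eq.symm ((smul_coe _ 0).trans (by simp [piInfty]))
      · refine InfCusp.ext ?_ ?_
        · exact Eq.symm ((smul_coe _ 0).trans (by simp [B]))
        · exact Eq.symm ((smul_infty _).trans (by simp [B]))
    refine trans _ _ _ (trans _ _ _ (h1 r) h2) ?_
    induction s with
    | infty =>
      have := act (mkG r (-1) 1 0 (by norm_num)) _ _ (h1 0)
      convert this using 1
      all_goals
        refine InfCusp.ext ?_ ?_
        · exact Eq.symm ((smul_infty _).trans (by simp [B]))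
        · exact Eq.symm ((smul_coe _ 0).trans (by simp [B]))
    | coe s =>
      have h : s - r ≠ 0 := sub_ne_zero.mpr fun h => hrs (congrArg _ h.symm)
      -- The map `z ↦ r - 1/z` sends `∞` to `r`, `0` to `∞`, and `-1/(s - r)` to `s`.
      have := act (mkG r (-1) 1 0 (by norm_num)) _ _ (h1 (-1 / (s - r)))
      convert this using 1
      · refine InfCusp.ext ?_ ?_
        · exact Eq.symm ((smul_infty _).trans (by simp [B]))
        · exact Eq.symm ((smul_coe _ 0).trans (by simp [B]))
      · refine InfCusp.ext ?_ ?_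
        · exact Eq.symm ((smul_infty _).trans (by simp))
        · refine Eq.symm ((smul_coe _ _).trans ?_)
          have h' : -1 / (s - r) ≠ 0 := div_ne_zero (by norm_num) h
          simp only [mkG_00, mkG_01, mkG_10, mkG_11, one_mul, add_zero, if_neg h']
          congr 1
          field_simp
          ring

/-! ### Coefficients of elements of `V_k(ℂ)` -/

variable {k : ℕ}

theorem expo_zero (k j : ℕ) : expo k j 0 = j := by simp [expo]

theorem expo_one (k j : ℕ) : expo k j 1 = k - 2 - j := by simp [expo]

theorem expo_inj {i j : ℕ} : expo k i = expo k j ↔ i = j :=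
  ⟨fun h => by simpa [expo_zero] using DFunLike.congr_fun h 0, fun h => h ▸ rfl⟩

/-- The coefficient map as a linear form. -/
def coeffL (k j : ℕ) : Vk k →ₗ[ℂ] ℂ where
  toFun P := coeffV j P
  map_add' _ _ := MvPolynomial.coeff_add _ _ _
  map_smul' _ _ := MvPolynomial.coeff_smul _ _ _

theorem coeffL_apply (j : ℕ) (P : Vk k) : coeffL k j P = coeffV j P := rfl

theorem coeffV_zero (j : ℕ) : coeffV j (0 : Vk k) = 0 := map_zero (coeffL k j)

theorem coeffV_add (j : ℕ) (P Q : Vk k) : coeffV j (P + Q) = coeffV j P + coeffV j Q :=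
  map_add (coeffL k j) P Q

theorem coeffV_sub (j : ℕ) (P Q : Vk k) : coeffV j (P - Q) = coeffV j P - coeffV j Q :=
  map_sub (coeffL k j) P Q

theorem coeffV_neg (j : ℕ) (P : Vk k) : coeffV j (-P) = -coeffV j P :=
  map_neg (coeffL k j) P

theorem coeffV_smul (j : ℕ) (c : ℂ) (P : Vk k) : coeffV j (c • P) = c * coeffV j P :=
  map_smul (coeffL k j) c P

theorem vk_ext {P Q : Vk k} (h : ∀ j ≤ k - 2, coeffV j P = coeffV j Q) : P = Q := by
  apply Subtype.ext
  ext d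
  by_cases hd : d.degree = k - 2
  · have e : d = expo k (d 0) := by
      have : d 0 + d 1 = k - 2 := by
        rw [← hd, Finsupp.degree_eq_sum, Fin.sum_univ_two]
      ext i
      fin_cases i
      · simp [expo_zero]
      · simp only [Fin.mk_one, expo_one]; omega
    have : d 0 ≤ k - 2 := by
      rw [← hd, Finsupp.degree_eq_sum, Fin.sum_univ_two]; omega
    rw [e]
    exact h _ this
  · rw [MvPolynomial.IsHomogeneous.coeff_eq_zero P.2 hd,
      MvPolynomial.IsHomogeneous.coeff_eq_zero Q.2 hd]

theorem coeffV_ofCoeffs (a : ℕ → ℂ) {j : ℕ} (hj : j ≤ k - 2) : coeffV j (ofCoeffs k a) = a j := by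
  rw [← coeffL_apply, ofCoeffs, map_sum]
  have (i : Fin (k - 2 + 1)) (h) :
      coeffL k j ⟨MvPolynomial.monomial (expo k i) (a i), h⟩ = if (i : ℕ) = j then a i else 0 := by
    show MvPolynomial.coeff _ (MvPolynomial.monomial _ _) = _
    simp only [MvPolynomial.coeff_monomial, expo_inj]
  refine (Finset.sum_congr rfl fun i _ => this i _).trans ?_
  rw [Fin.sum_univ_eq_sum_range (fun i => if i = j then a i else 0)]
  simp [Nat.lt_succ_of_le hj]

/-- The monomial `x ^ j * y ^ (k - 2 - j)`. -/
def monoV (k j : ℕ) : Vk k := ofCoeffs k (Pi.single j 1)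

theorem eq_sum_monoV (P : Vk k) : P = ∑ j ∈ Finset.range (k - 2 + 1), coeffV j P • monoV k j := by
  refine vk_ext fun i hi => ?_
  rw [← coeffL_apply, ← coeffL_apply, map_sum]
  have (j : ℕ) : coeffL k i (coeffV j P • monoV k j) = if i = j then coeffV j P else 0 := by
    rw [map_smul, coeffL_apply, monoV, coeffV_ofCoeffs _ hi]
    simp [Pi.single_apply]
  simp only [this, coeffL_apply]
  simp [Nat.lt_succ_of_le hi]

theorem map_eq_sum (ℓ : Vk k →ₗ[ℂ] ℂ) (P : Vk k) :
    ℓ P = ∑ j ∈ Finset.range (k - 2 + 1), coeffV j P * ℓ (monoV k j) := by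
  conv_lhs => rw [eq_sum_monoV P, map_sum]
  simp

theorem coeffV_linPow (t : ℂ) {j : ℕ} (hj : j ≤ k - 2) :
    coeffV j (linPow k t) = ((k - 2).choose j : ℂ) * t ^ j := by
  show MvPolynomial.coeff (expo k j)
    ((MvPolynomial.C t * MvPolynomial.X 0 + MvPolynomial.X 1) ^ (k - 2)) = _
  rw [add_pow, MvPolynomial.coeff_sum]
  have (m : ℕ) (hm : m ≤ k - 2) : MvPolynomial.coeff (expo k j)
      ((MvPolynomial.C t * MvPolynomial.X 0) ^ m * MvPolynomial.X 1 ^ (k - 2 - m) *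
        ((k - 2).choose m : MvPolynomial (Fin 2) ℂ)) =
      if m = j then ((k - 2).choose m : ℂ) * t ^ m else 0 := by
    have e : (MvPolynomial.C t * MvPolynomial.X 0) ^ m * MvPolynomial.X 1 ^ (k - 2 - m) *
        ((k - 2).choose m : MvPolynomial (Fin 2) ℂ) =
        MvPolynomial.monomial (expo k m) (((k - 2).choose m : ℂ) * t ^ m) := by
      rw [MvPolynomial.monomial_eq, Finsupp.prod_fintype _ _ (by simp), Fin.prod_univ_two,
        expo_zero, expo_one, map_mul, map_pow, map_natCast]
      ring
    rw [e, MvPolynomial.coeff_monomial]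
    simp only [expo_inj]
  rw [Finset.sum_congr rfl fun m hm => this m (Nat.lt_succ_iff.mp (Finset.mem_range.mp hm))]
  simp [Nat.lt_succ_of_le hj]

theorem coeffV_intV (S : Set ℝ) (f : ℝ → Vk k) {j : ℕ} (hj : j ≤ k - 2) :
    coeffV j (intV S f) = ∫ u in S, coeffV j (f u) :=
  coeffV_ofCoeffs _ hj

theorem coeffV_rayInt (g : ℂ → Vk k) (z : ℂ) {j : ℕ} (hj : j ≤ k - 2) :
    coeffV j (rayInt g z) =
      Complex.I * ∫ u : ℝ in Set.Ioi 0, coeffV j (g (z + Complex.I * u)) := by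
  rw [rayInt, coeffV_intV _ _ hj]
  simp only [coeffV_smul]
  rw [integral_const_mul]

/-- Integrals in `V_k` are defined coefficientwise; integrability of each coefficient lets any
linear form, not only a coordinate, pass under the integral. -/
theorem map_intV (ℓ : Vk k →ₗ[ℂ] ℂ) {S : Set ℝ} {f : ℝ → Vk k}
    (hf : ∀ j ≤ k - 2, IntegrableOn (fun u => coeffV j (f u)) S) :
    ℓ (intV S f) = ∫ u in S, ℓ (f u) := by
  rw [map_eq_sum]
  simp_rw [map_eq_sum ℓ (f _)]
  rw [integral_finsetSum]
  · refine Finset.sum_congr rfl fun j hj => ?_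
    rw [coeffV_intV _ _ (Nat.lt_succ_iff.mp (Finset.mem_range.mp hj)), integral_mul_const]
  · intro j hj
    exact (hf j (Nat.lt_succ_iff.mp (Finset.mem_range.mp hj))).mul_const _

theorem slashV_rayInt (γ : G) {g : ℂ → Vk k} {z : ℂ} (hg : RayIntegrable g z) :
    slashV γ (rayInt g z) = rayInt (fun t => slashV γ (g t)) z := by
  refine vk_ext fun j hj => ?_
  have := map_intV ((coeffL k j).comp (slashV γ)) (S := Set.Ioi 0)
    (f := fun u : ℝ => Complex.I • g (z + Complex.I * u)) (fun i hi => by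
      simp only [coeffV_smul]
      exact (hg i hi).const_mul _)
  rw [rayInt, rayInt, coeffV_intV _ _ hj]
  simpa only [LinearMap.comp_apply, map_smul, coeffL_apply, coeffV_smul, smul_eq_mul] using this

theorem coe_slashV (γ : G) (P : Vk k) :
    (slashV γ P : MvPolynomial (Fin 2) ℂ) = MvPolynomial.aeval (substForms γ) P.1 := rfl

theorem coe_linPow (k : ℕ) (t : ℂ) : (linPow k t : MvPolynomial (Fin 2) ℂ) =
    (MvPolynomial.C t * MvPolynomial.X 0 + MvPolynomial.X 1) ^ (k - 2) := rfl

/-- `((t x + y)^{k-2})|γ` is a multiple of `(γ t x + y)^{k-2}`. -/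
theorem slashV_linPow (γ : G) (z w : ℂ)
    (h : w * ((γ.1 1 0 : ℚ) * z + (γ.1 1 1 : ℚ)) = (γ.1 0 0 : ℚ) * z + (γ.1 0 1 : ℚ)) :
    (((γ.1 1 0 : ℚ) * z + (γ.1 1 1 : ℚ) : ℂ)) ^ (k - 2) • slashV γ (linPow k w) =
      (((γ.1).det.val : ℚ) : ℂ) ^ (k - 2) • linPow k z := by
  have h' : (MvPolynomial.C w : MvPolynomial (Fin 2) ℂ) *
      (MvPolynomial.C ((γ.1 1 0 : ℚ) : ℂ) * MvPolynomial.C z + MvPolynomial.C ((γ.1 1 1 : ℚ) : ℂ)) =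
      MvPolynomial.C ((γ.1 0 0 : ℚ) : ℂ) * MvPolynomial.C z +
        MvPolynomial.C ((γ.1 0 1 : ℚ) : ℂ) := by
    simpa only [map_add, map_mul] using congrArg (MvPolynomial.C (σ := Fin 2)) h
  have key : MvPolynomial.C ((γ.1 1 0 : ℚ) * z + (γ.1 1 1 : ℚ) : ℂ) *
      MvPolynomial.aeval (substForms γ)
        (MvPolynomial.C w * MvPolynomial.X 0 + MvPolynomial.X 1 : MvPolynomial (Fin 2) ℂ) =
      MvPolynomial.C (((γ.1).det.val : ℚ) : ℂ) *
        (MvPolynomial.C z * MvPolynomial.X 0 + MvPolynomial.X 1) := by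
    rw [det_eq]
    push_cast
    simp only [map_add, map_sub, map_mul, MvPolynomial.aeval_X, MvPolynomial.aeval_C,
      MvPolynomial.algebraMap_eq, substForms, Matrix.cons_val_zero, Matrix.cons_val_one]
    linear_combination (MvPolynomial.C ((γ.1 1 1 : ℚ) : ℂ) * MvPolynomial.X 0 -
      MvPolynomial.C ((γ.1 1 0 : ℚ) : ℂ) * MvPolynomial.X 1) * h'
  apply Subtype.ext
  rw [Submodule.coe_smul, Submodule.coe_smul, coe_slashV, coe_linPow, coe_linPow,
    MvPolynomial.smul_eq_C_mul, MvPolynomial.smul_eq_C_mul, map_pow, map_pow, map_pow,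
    ← mul_pow, ← mul_pow, key]

/-! ### Holomorphic functions of rapid decay on the upper half plane -/

/-- Holomorphic functions on the upper half plane that decay exponentially at `i∞`, uniformly on
vertical strips that are bounded away from the real axis. -/
structure RapidDecay (g : ℂ → ℂ) : Prop where
  diff : DifferentiableOn ℂ g {z | 0 < z.im}
  bound : ∀ R y : ℝ, 0 < y → ∃ c : ℝ, 0 < c ∧ ∃ C : ℝ, 0 ≤ C ∧
    ∀ w : ℂ, |w.re| ≤ R → y ≤ w.im → ‖g w‖ ≤ C * Real.exp (-c * w.im)

theorem isOpen_upper : IsOpen {z : ℂ | 0 < z.im} :=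
  isOpen_lt continuous_const Complex.continuous_im

theorem RapidDecay.const_mul {g : ℂ → ℂ} (hg : RapidDecay g) (a : ℂ) :
    RapidDecay fun w => a * g w where
  diff := hg.diff.const_mul a
  bound R y hy := by
    obtain ⟨c, hc, C, hC, h⟩ := hg.bound R y hy
    refine ⟨c, hc, ‖a‖ * C, by positivity, fun w h1 h2 => ?_⟩
    rw [norm_mul, mul_assoc]
    gcongr
    exact h w h1 h2

theorem RapidDecay.mul_id {g : ℂ → ℂ} (hg : RapidDecay g) : RapidDecay fun w => g w * w where
  diff := hg.diff.mul differentiableOn_id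
  bound R y hy := by
    obtain ⟨c, hc, C, hC, h⟩ := hg.bound R y hy
    -- Half of the exponential pays for the growth of `‖w‖`; the term `2 / c` comes from `v ≤ e^v`
    -- with `v = c/2 · Im w`.
    refine ⟨c / 2, by positivity, C * (|R| + 2 / c), by positivity, fun w h1 h2 => ?_⟩
    have e : Real.exp (-c * w.im) = Real.exp (-(c / 2) * w.im) * Real.exp (-(c / 2) * w.im) := by
      rw [← Real.exp_add]; congr 1; ring
    have hw : ‖w‖ * Real.exp (-(c / 2) * w.im) ≤ |R| + 2 / c := by
      have h3 : ‖w‖ ≤ |R| + w.im := by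
        refine (Complex.norm_le_abs_re_add_abs_im w).trans ?_
        rw [abs_of_nonneg (hy.le.trans h2)]
        exact add_le_add_left (h1.trans (le_abs_self R)) _
      have h4 : c / 2 * w.im ≤ Real.exp (c / 2 * w.im) :=
        (le_add_of_nonneg_right zero_le_one).trans (Real.add_one_le_exp _)
      have h5 : Real.exp (-(c / 2) * w.im) ≤ 1 := by
        rw [Real.exp_le_one_iff]
        nlinarith
      have h6 : w.im * Real.exp (-(c / 2) * w.im) ≤ 2 / c := by
        rw [neg_mul, Real.exp_neg, ← div_eq_mul_inv, div_le_iff₀ (Real.exp_pos _)]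
        calc w.im = 2 / c * (c / 2 * w.im) := by field_simp
          _ ≤ _ := by gcongr
      calc ‖w‖ * Real.exp (-(c / 2) * w.im)
          ≤ (|R| + w.im) * Real.exp (-(c / 2) * w.im) := by gcongr
        _ = |R| * Real.exp (-(c / 2) * w.im) + w.im * Real.exp (-(c / 2) * w.im) := by ring
        _ ≤ |R| * 1 + 2 / c := by gcongr
        _ = _ := by ring
    calc ‖g w * w‖ = ‖g w‖ * ‖w‖ := norm_mul _ _
      _ ≤ C * Real.exp (-c * w.im) * ‖w‖ := by gcongr; exact h w h1 h2
      _ = C * (‖w‖ * Real.exp (-(c / 2) * w.im)) * Real.exp (-(c / 2) * w.im) := by rw [e]; ring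
      _ ≤ _ := by gcongr

theorem RapidDecay.mul_pow {g : ℂ → ℂ} (hg : RapidDecay g) (j : ℕ) :
    RapidDecay fun w => g w * w ^ j := by
  induction j with
  | zero => simpa using hg
  | succ j ih => simpa only [pow_succ, mul_assoc] using ih.mul_id

/-- Cauchy's estimate on circles of radius `y/2`, which stay in a slightly larger strip at height at
least `y/2`. -/
theorem rapidDecay_deriv {g : ℂ → ℂ} (hg : RapidDecay g) : RapidDecay (deriv g) where
  diff := hg.diff.deriv isOpen_upper
  bound R y hy := by
    obtain ⟨c, hc, C, hC, h⟩ := hg.bound (R + y / 2) (y / 2) (by positivity)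
    refine ⟨c, hc, C * Real.exp (c * (y / 2)) / (y / 2), by positivity, fun w h1 h2 => ?_⟩
    have hre (z : ℂ) (hz : z ∈ Metric.closedBall w (y / 2)) :
        |z.re| ≤ R + y / 2 ∧ w.im - y / 2 ≤ z.im := by
      have h3 : ‖z - w‖ ≤ y / 2 := by simpa [dist_eq_norm] using hz
      have h4 := (Complex.abs_re_le_norm (z - w)).trans h3
      have h5 := (Complex.abs_im_le_norm (z - w)).trans h3
      rw [Complex.sub_re] at h4
      rw [Complex.sub_im, abs_le] at h5
      refine ⟨?_, by linarith [h5.1]⟩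
      have := abs_add_le w.re (z.re - w.re)
      rw [add_sub_cancel] at this
      linarith
    have hd : DiffContOnCl ℂ g (Metric.ball w (y / 2)) := by
      refine DifferentiableOn.diffContOnCl ?_
      refine hg.diff.mono fun z hz => ?_
      have := (hre z (Metric.closure_ball_subset_closedBall hz)).2
      show 0 < z.im
      linarith
    have := Complex.norm_deriv_le_of_forall_mem_sphere_norm_le (by positivity) hd
      (C := C * Real.exp (c * (y / 2)) * Real.exp (-c * w.im)) fun z hz => by
        obtain ⟨h3, h4⟩ := hre z (Metric.sphere_subset_closedBall hz)
        refine (h z h3 (by linarith)).trans ?_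
        rw [mul_assoc, ← Real.exp_add]
        gcongr
        nlinarith
    refine this.trans_eq ?_
    ring

theorem hasDerivAt_add_I_mul (z : ℂ) (u : ℝ) :
    HasDerivAt (fun v : ℝ => z + Complex.I * (v : ℂ)) Complex.I u := by
  simpa using ((Complex.ofRealCLM.hasDerivAt (x := u)).const_mul Complex.I).const_add z

theorem add_I_mul_im (z : ℂ) (u : ℝ) : (z + Complex.I * u).im = z.im + u := by simp

theorem add_I_mul_re (z : ℂ) (u : ℝ) : (z + Complex.I * u).re = z.re := by simp

theorem RapidDecay.continuousOn_ray {g : ℂ → ℂ} (hg : RapidDecay g) {z : ℂ} (hz : 0 < z.im) :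
    ContinuousOn (fun u : ℝ => g (z + Complex.I * u)) (Set.Ici 0) := by
  refine hg.diff.continuousOn.comp (by fun_prop) fun u (hu : 0 ≤ u) => ?_
  show 0 < (z + Complex.I * u).im
  rw [add_I_mul_im]; positivity

theorem RapidDecay.bound_ray {g : ℂ → ℂ} (hg : RapidDecay g) {z : ℂ} (hz : 0 < z.im) :
    ∃ c : ℝ, 0 < c ∧ ∃ C : ℝ, 0 ≤ C ∧ ∀ u : ℝ, 0 ≤ u →
      ‖g (z + Complex.I * u)‖ ≤ C * Real.exp (-c * u) := by
  obtain ⟨c, hc, C, hC, h⟩ := hg.bound |z.re| z.im hz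
  refine ⟨c, hc, C, hC, fun u hu => ?_⟩
  refine (h _ (by rw [add_I_mul_re]) (by rw [add_I_mul_im]; linarith)).trans ?_
  rw [add_I_mul_im]
  refine mul_le_mul_of_nonneg_left (Real.exp_le_exp.mpr ?_) hC
  nlinarith

theorem RapidDecay.integrableOn_ray {g : ℂ → ℂ} (hg : RapidDecay g) {z : ℂ} (hz : 0 < z.im) :
    IntegrableOn (fun u : ℝ => g (z + Complex.I * u)) (Set.Ioi 0) := by
  obtain ⟨c, hc, C, hC, h⟩ := hg.bound_ray hz
  refine Integrable.mono' ((exp_neg_integrableOn_Ioi 0 hc).const_mul C)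
    (((hg.continuousOn_ray hz).mono Set.Ioi_subset_Ici_self).aestronglyMeasurable
      measurableSet_Ioi) ?_
  exact (ae_restrict_iff' measurableSet_Ioi).mpr (ae_of_all _ fun u hu => h u (le_of_lt hu))

theorem RapidDecay.tendsto_ray {g : ℂ → ℂ} (hg : RapidDecay g) {z : ℂ} (hz : 0 < z.im) :
    Tendsto (fun u : ℝ => g (z + Complex.I * u)) atTop (𝓝 0) := by
  obtain ⟨c, hc, C, hC, h⟩ := hg.bound_ray hz
  refine squeeze_zero_norm' ((eventually_ge_atTop 0).mono h) ?_
  have : Tendsto (fun u : ℝ => Real.exp (-c * u)) atTop (𝓝 0) :=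
    Real.tendsto_exp_atBot.comp (tendsto_id.const_mul_atTop_of_neg (by linarith))
  simpa using this.const_mul C

/-- Decay of `g'`, uniform for base points near `z`, allows differentiation under the integral. The
new integrand is the `u`-derivative of `g(z + iu)`, so only the endpoint `u = 0` contributes. -/
theorem RapidDecay.hasDerivAt_ray {g : ℂ → ℂ} (hg : RapidDecay g) {z : ℂ} (hz : 0 < z.im) :
    HasDerivAt (fun z : ℂ => Complex.I * ∫ u : ℝ in Set.Ioi 0, g (z + Complex.I * u)) (-g z) z := by
  have hat (w : ℂ) (hw : 0 < w.im) : HasDerivAt g (deriv g w) w :=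
    (hg.diff.differentiableAt (isOpen_upper.mem_nhds hw)).hasDerivAt
  have hend : Complex.I * ∫ u : ℝ in Set.Ioi 0, deriv g (z + Complex.I * u) = -g z := by
    rw [← integral_const_mul, integral_Ioi_of_hasDerivAt_of_tendsto' (m := 0)
      (f := fun u : ℝ => g (z + Complex.I * u))]
    · simp
    · intro u (hu : 0 ≤ u)
      rw [mul_comm]
      exact (hat (z + Complex.I * u) (by rw [add_I_mul_im]; positivity)).comp u
        (hasDerivAt_add_I_mul z u)
    · exact ((rapidDecay_deriv hg).integrableOn_ray hz).const_mul _
    · exact hg.tendsto_ray hz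
  rw [← hend]
  refine HasDerivAt.const_mul _ ?_
  obtain ⟨c, hc, C, hC, h⟩ := (rapidDecay_deriv hg).bound (|z.re| + z.im / 2) (z.im / 2) (by positivity)
  have hball (w : ℂ) (hw : w ∈ Metric.ball z (z.im / 2)) :
      |w.re| ≤ |z.re| + z.im / 2 ∧ z.im / 2 ≤ w.im := by
    have h3 : ‖w - z‖ < z.im / 2 := by simpa [dist_eq_norm] using hw
    have h4 := (Complex.abs_re_le_norm (w - z)).trans h3.le
    have h5 := (Complex.abs_im_le_norm (w - z)).trans h3.le
    rw [Complex.sub_re] at h4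
    rw [Complex.sub_im, abs_le] at h5
    refine ⟨?_, by linarith [h5.1]⟩
    have := abs_add_le z.re (w.re - z.re)
    rw [add_sub_cancel] at this
    linarith
  have hnhds : Metric.ball z (z.im / 2) ∈ 𝓝 z := Metric.ball_mem_nhds z (by positivity)
  refine (hasDerivAt_integral_of_dominated_loc_of_deriv_le (μ := volume.restrict (Set.Ioi 0))
    (F := fun (w : ℂ) (u : ℝ) => g (w + Complex.I * u))
    (F' := fun (w : ℂ) (u : ℝ) => deriv g (w + Complex.I * u))
    (bound := fun u => C * Real.exp (-c * u)) hnhds ?_ ?_ ?_ ?_ ?_ ?_).2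
  · filter_upwards [hnhds] with w hw
    have := (hball w hw).2
    exact (hg.integrableOn_ray (by linarith)).aestronglyMeasurable
  · exact hg.integrableOn_ray hz
  · exact ((rapidDecay_deriv hg).integrableOn_ray hz).aestronglyMeasurable
  · refine (ae_restrict_iff' measurableSet_Ioi).mpr (ae_of_all _ fun u (hu : 0 < u) w hw => ?_)
    obtain ⟨h1, h2⟩ := hball w hw
    refine (h _ (by rwa [add_I_mul_re]) (by rw [add_I_mul_im]; linarith)).trans ?_
    rw [add_I_mul_im]
    refine mul_le_mul_of_nonneg_left (Real.exp_le_exp.mpr ?_) hC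
    nlinarith
  · exact (exp_neg_integrableOn_Ioi 0 hc).const_mul C
  · refine (ae_restrict_iff' measurableSet_Ioi).mpr (ae_of_all _ fun u (hu : 0 < u) w hw => ?_)
    have := (hball w hw).2
    exact (hat (w + Complex.I * u) (by rw [add_I_mul_im]; linarith)).comp_add_const w _

/-! ### Modular forms near the cusp at infinity -/

theorem differentiableOn_form (F : Mk k) :
    DifferentiableOn ℂ (fun z => (F : ℍ → ℂ) (ofComplex z)) {z | 0 < z.im} := by
  obtain ⟨F, Γ, hΓ, f, rfl⟩ := F
  exact UpperHalfPlane.mdifferentiable_iff.mp (ModularFormClass.holo f)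

theorem exists_exp_decay (F : Mk k) : ∃ c > 0,
    (fun τ => (F : ℍ → ℂ) τ - a0 F) =O[atImInfty] fun τ => Real.exp (-c * τ.im) := by
  obtain ⟨F, Γ, hΓ, f, rfl⟩ := F
  have := hΓ.finiteIndex
  exact ModularFormClass.exp_decay_sub_atImInfty' f

theorem rapidDecay_tildeF (F : Mk k) : RapidDecay (tildeF F) where
  diff := (differentiableOn_form F).sub_const _
  -- Above some height `Y` the Fourier expansion gives the decay; the remaining rectangle is
  -- compact, and the factor `e^{cY}` makes the bound there fit the exponential.
  bound R y hy := by
    obtain ⟨c, hc, h⟩ := exists_exp_decay F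
    obtain ⟨C, hC, hb⟩ := h.exists_nonneg
    obtain ⟨Y, hY⟩ := (atImInfty_mem _).mp hb.bound
    obtain ⟨B, hB⟩ := ((isCompact_Icc (a := -R) (b := R)).reProdIm
      (isCompact_Icc (a := y) (b := Y))).exists_bound_of_continuousOn
      (f := tildeF F) (((differentiableOn_form F).sub_const _).continuousOn.mono fun z hz => by
        have := (Complex.mem_reProdIm.mp hz).2.1
        show 0 < z.im
        linarith)
    refine ⟨c, hc, max C (|B| * Real.exp (c * Y)), by positivity, fun w h1 h2 => ?_⟩
    rcases le_total Y w.im with h3 | h3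
    · have hw : 0 < w.im := by linarith
      have := hY ⟨w, hw⟩ h3
      simp only [Set.mem_ofPred_eq, Real.norm_eq_abs, Real.abs_exp] at this
      rw [tildeF, ofComplex_apply_of_im_pos hw]
      refine this.trans ?_
      exact mul_le_mul_of_nonneg_right (le_max_left _ _) (Real.exp_nonneg _)
    · refine (hB w (Complex.mem_reProdIm.mpr ⟨abs_le.mp h1, h2, h3⟩)).trans ?_
      calc B ≤ |B| * 1 := by rw [mul_one]; exact le_abs_self B
        _ ≤ |B| * (Real.exp (c * Y) * Real.exp (-c * w.im)) := by
          gcongr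
          rw [← Real.exp_add, Real.one_le_exp_iff]
          nlinarith
        _ = |B| * Real.exp (c * Y) * Real.exp (-c * w.im) := by ring
        _ ≤ _ := by gcongr; exact le_max_right _ _

/-- `valueAtInfty` is a `limUnder`, which means something only once the limit is known to exist; the
decay of `F - a₀(F)` supplies it. -/
theorem tendsto_a0 (F : Mk k) : Tendsto (F : ℍ → ℂ) atImInfty (𝓝 (a0 F)) := by
  obtain ⟨c, hc, h⟩ := exists_exp_decay F
  have h2 : Tendsto (fun τ : ℍ => Real.exp (-c * τ.im)) atImInfty (𝓝 0) :=
    Real.tendsto_exp_atBot.comp ((tendsto_comap).const_mul_atTop_of_neg (by linarith))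
  simpa using (h.trans_tendsto h2).add_const (a0 (F : ℍ → ℂ))

instance : (atImInfty).NeBot := by
  rw [atImInfty, comap_neBot_iff_frequently]
  refine Eventually.frequently ?_
  filter_upwards [eventually_gt_atTop 0] with y hy
  exact ⟨⟨Complex.I * y, by simpa using hy⟩, by simp [← coe_im]⟩

theorem a0_eq_of_tendsto {f : ℍ → ℂ} {a : ℂ} (h : Tendsto f atImInfty (𝓝 a)) : a0 f = a :=
  h.limUnder_eq

theorem a0_add (F F' : Mk k) : a0 (F + F' : Mk k) = a0 F + a0 F' :=
  a0_eq_of_tendsto ((tendsto_a0 F).add (tendsto_a0 F'))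

theorem a0_smul (c : ℂ) (F : Mk k) : a0 (c • F : Mk k) = c * a0 F :=
  a0_eq_of_tendsto ((tendsto_a0 F).const_mul c)

/-! ### The Eichler integral is a primitive -/

theorem coeffV_tildeF_smul_linPow (F : ℍ → ℂ) (t : ℂ) {j : ℕ} (hj : j ≤ k - 2) :
    coeffV j (tildeF F t • linPow k t) = ((k - 2).choose j : ℂ) * (tildeF F t * t ^ j) := by
  rw [coeffV_smul, coeffV_linPow _ hj]; ring

theorem rapidDecay_coeffV (F : Mk k) {j : ℕ} (hj : j ≤ k - 2) :
    RapidDecay fun t => coeffV j (tildeF F t • linPow k t) := by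
  simp only [coeffV_tildeF_smul_linPow _ _ hj]
  exact ((rapidDecay_tildeF F).mul_pow j).const_mul _

theorem rayIntegrable_form (F : Mk k) {z : ℂ} (hz : 0 < z.im) :
    RayIntegrable (fun t => tildeF (F : ℍ → ℂ) t • linPow k t) z :=
  fun _ hj => (rapidDecay_coeffV F hj).integrableOn_ray hz

theorem coeffV_linInt (z : ℂ) {j : ℕ} (hj : j ≤ k - 2) :
    coeffV j (linInt k z) = ((k - 2).choose j : ℂ) * (z ^ (j + 1) / (j + 1)) := by
  rw [linInt, coeffV_intV _ _ hj, ← integral_Ioc_eq_integral_Ioo,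
    ← intervalIntegral.integral_of_le zero_le_one]
  have (u : ℝ) : coeffV j (z • linPow k (u * z)) =
      ((k - 2).choose j : ℂ) * z ^ (j + 1) * (u : ℂ) ^ j := by
    rw [coeffV_smul, coeffV_linPow _ hj]; ring
  simp only [this]
  rw [intervalIntegral.integral_const_mul]
  have h : ∫ u : ℝ in (0 : ℝ)..1, (u : ℂ) ^ j = ((∫ u : ℝ in (0 : ℝ)..1, u ^ j : ℝ) : ℂ) := by
    rw [← intervalIntegral.integral_ofReal]
    simp
  rw [h, integral_pow]
  simp
  ring

theorem linInt_zero : linInt k 0 = 0 :=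
  vk_ext fun j hj => by rw [coeffV_linInt _ hj, coeffV_zero]; simp

theorem hasDerivAt_linInt (ℓ : Vk k →ₗ[ℂ] ℂ) (z : ℂ) :
    HasDerivAt (fun z => ℓ (linInt k z)) (ℓ (linPow k z)) z := by
  simp_rw [map_eq_sum ℓ (linInt k _)]
  rw [map_eq_sum ℓ (linPow k z)]
  refine HasDerivAt.fun_sum fun j hj => ?_
  have hj' : j ≤ k - 2 := Nat.lt_succ_iff.mp (Finset.mem_range.mp hj)
  refine HasDerivAt.mul_const ?_ _
  simp only [coeffV_linInt _ hj', coeffV_linPow _ hj']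
  refine HasDerivAt.const_mul _ ?_
  have h : ((j : ℂ) + 1) ≠ 0 := Nat.cast_add_one_ne_zero j
  convert! ((hasDerivAt_pow (j + 1) z).div_const ((j : ℂ) + 1)) using 1
  push_cast
  field_simp

/-- The Eichler integral as a function of a complex variable. -/
def eichler (k : ℕ) (F : ℍ → ℂ) (z : ℂ) : Vk k :=
  - rayInt (fun t => tildeF F t • linPow k t) z + a0 F • linInt k z

theorem W_eq_eichler (F : ℍ → ℂ) (τ : ℍ) : W k F τ = eichler k F τ := rfl

/-- The `-a₀(F)` in the ray integral is compensated by the derivative of the polynomial integral,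
leaving the full form `F(z)(zx+y)^{k-2}`. Linear forms reduce this to scalar calculus. -/
theorem hasDerivAt_eichler (F : Mk k) (ℓ : Vk k →ₗ[ℂ] ℂ) {z : ℂ} (hz : 0 < z.im) :
    HasDerivAt (fun z => ℓ (eichler k F z)) ((F : ℍ → ℂ) (ofComplex z) * ℓ (linPow k z)) z := by
  have h1 : HasDerivAt (fun z => ℓ (rayInt (fun t => tildeF (F : ℍ → ℂ) t • linPow k t) z))
      (-(tildeF F z * ℓ (linPow k z))) z := by
    simp_rw [map_eq_sum ℓ (rayInt _ _)]
    rw [map_eq_sum ℓ (linPow k z), Finset.mul_sum, ← Finset.sum_neg_distrib]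
    refine HasDerivAt.fun_sum fun j hj => ?_
    have hj' : j ≤ k - 2 := Nat.lt_succ_iff.mp (Finset.mem_range.mp hj)
    simp only [coeffV_rayInt _ _ hj']
    rw [← mul_assoc, ← neg_mul, ← coeffV_smul]
    exact ((rapidDecay_coeffV F hj').hasDerivAt_ray hz).mul_const _
  simp only [eichler, map_add, map_neg, map_smul, smul_eq_mul]
  convert! h1.neg.add ((hasDerivAt_linInt ℓ z).const_mul (a0 F)) using 1
  rw [tildeF]; ring

/-! ### Möbius transformations -/

/-- The Möbius transformation attached to `γ` on the complex plane. -/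
def moebius (γ : G) (z : ℂ) : ℂ :=
  ((γ.1 0 0 : ℚ) * z + (γ.1 0 1 : ℚ)) / ((γ.1 1 0 : ℚ) * z + (γ.1 1 1 : ℚ))

/-- The determinant of `γ` as a complex number. -/
def detC (γ : G) : ℂ := (((γ.1).det.val : ℚ) : ℂ)

/-- The automorphy factor `c z + d`. -/
def autFactor (γ : G) (z : ℂ) : ℂ := (γ.1 1 0 : ℚ) * z + (γ.1 1 1 : ℚ)

theorem detC_eq (γ : G) : detC γ = (γ.1 0 0 : ℚ) * (γ.1 1 1 : ℚ) - (γ.1 0 1 : ℚ) * (γ.1 1 0 : ℚ) := by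
  rw [detC, det_eq]; push_cast; rfl

theorem denom_toGLR (γ : G) (z : ℂ) : denom (toGLR γ) z = autFactor γ z := by
  simp [denom, toGLR, autFactor]

theorem num_toGLR (γ : G) (z : ℂ) : num (toGLR γ) z = (γ.1 0 0 : ℚ) * z + (γ.1 0 1 : ℚ) := by
  simp [num, toGLR]

theorem coe_toGLR_smul (γ : G) (τ : ℍ) : ((toGLR γ • τ : ℍ) : ℂ) = moebius γ τ := by
  rw [coe_smul_of_det_pos (det_toGLR_pos γ), num_toGLR, denom_toGLR]
  rfl

theorem autFactor_ne_zero (γ : G) {z : ℂ} (hz : 0 < z.im) : autFactor γ z ≠ 0 := by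
  rw [← denom_toGLR]
  exact denom_ne_zero (toGLR γ) ⟨z, hz⟩

theorem moebius_im_pos (γ : G) {z : ℂ} (hz : 0 < z.im) : 0 < (moebius γ z).im := by
  have := coe_toGLR_smul γ ⟨z, hz⟩
  exact this ▸ (toGLR γ • (⟨z, hz⟩ : ℍ)).im_pos

theorem toGLR_smul_ofComplex (γ : G) {z : ℂ} (hz : 0 < z.im) :
    toGLR γ • ofComplex z = ofComplex (moebius γ z) := by
  rw [ofComplex_apply_of_im_pos hz, ofComplex_apply_of_im_pos (moebius_im_pos γ hz)]
  ext
  rw [coe_toGLR_smul]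

theorem hasDerivAt_moebius (γ : G) {z : ℂ} (hz : autFactor γ z ≠ 0) :
    HasDerivAt (moebius γ) (detC γ / autFactor γ z ^ 2) z := by
  have h1 : HasDerivAt (fun z : ℂ => ((γ.1 0 0 : ℚ) : ℂ) * z + (γ.1 0 1 : ℚ)) (γ.1 0 0 : ℚ) z := by
    simpa using ((hasDerivAt_id z).const_mul ((γ.1 0 0 : ℚ) : ℂ)).add_const ((γ.1 0 1 : ℚ) : ℂ)
  have h2 : HasDerivAt (fun z : ℂ => ((γ.1 1 0 : ℚ) : ℂ) * z + (γ.1 1 1 : ℚ)) (γ.1 1 0 : ℚ) z := by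
    simpa using ((hasDerivAt_id z).const_mul ((γ.1 1 0 : ℚ) : ℂ)).add_const ((γ.1 1 1 : ℚ) : ℂ)
  convert! h1.fun_div h2 hz using 1
  rw [detC_eq, autFactor]
  ring

theorem slashV_linPow_moebius (γ : G) {z : ℂ} (hz : autFactor γ z ≠ 0) :
    slashV γ (linPow k (moebius γ z)) = (detC γ / autFactor γ z) ^ (k - 2) • linPow k z := by
  have h := slashV_linPow (k := k) γ z (moebius γ z) (div_mul_cancel₀ _ hz)
  have h2 : autFactor γ z ^ (k - 2) ≠ 0 := pow_ne_zero _ hz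
  rw [div_pow, div_eq_inv_mul, mul_smul]
  exact (eq_inv_smul_iff₀ h2).mpr h

/-! ### The right actions -/

theorem slashM_mul (γ δ : G) (F : Mk k) : slashM (γ * δ) F = slashM δ (slashM γ F) := by
  apply Subtype.ext
  show (F : ℍ → ℂ) ∣[(k : ℤ)] toGLR (γ * δ) = ((F : ℍ → ℂ) ∣[(k : ℤ)] toGLR γ) ∣[(k : ℤ)] toGLR δ
  rw [map_mul, SlashAction.slash_mul]

theorem slashM_one (F : Mk k) : slashM 1 F = F := by
  apply Subtype.ext
  show (F : ℍ → ℂ) ∣[(k : ℤ)] toGLR 1 = F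
  rw [map_one, SlashAction.slash_one]

theorem slashM_slashM_inv (γ : G) (F : Mk k) : slashM γ (slashM γ⁻¹ F) = F := by
  rw [← slashM_mul, inv_mul_cancel, slashM_one]

theorem form_eq_slashM_inv (hk : 2 ≤ k) (F : Mk k) (γ : G) (τ : ℍ) :
    (F : ℍ → ℂ) τ = detC γ ^ (k - 1) / autFactor γ τ ^ k *
      (slashM γ⁻¹ F : ℍ → ℂ) (toGLR γ • τ) := by
  have h := slashM_apply γ (slashM γ⁻¹ F) τ
  rw [slashM_slashM_inv] at h
  rw [h]
  have e : (k : ℤ) - 1 = ((k - 1 : ℕ) : ℤ) := by omega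
  rw [e, zpow_natCast, zpow_neg, zpow_natCast]
  rfl

theorem form_eq_slashM_inv_ofComplex (hk : 2 ≤ k) (F : Mk k) (γ : G) {z : ℂ} (hz : 0 < z.im) :
    (F : ℍ → ℂ) (ofComplex z) = detC γ ^ (k - 1) / autFactor γ z ^ k *
      (slashM γ⁻¹ F : ℍ → ℂ) (ofComplex (moebius γ z)) := by
  rw [form_eq_slashM_inv hk F γ (ofComplex z), toGLR_smul_ofComplex γ hz,
    ofComplex_apply_of_im_pos hz]

/-! ### The cocycle attached to a modular form -/

theorem cocycleFun_const (hk : 2 ≤ k) (F : Mk k) (γ : G) (τ τ' : ℍ) :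
    cocycleFun F γ τ = cocycleFun F γ τ' := by
  refine vk_ext fun j hj => ?_
  let D : ℂ → ℂ := fun z => coeffL k j (eichler k F z) -
    ((coeffL k j).comp (slashV γ)) (eichler k (slashM γ⁻¹ F : Mk k) (moebius γ z))
  have hD (z : ℂ) (hz : 0 < z.im) : HasDerivAt D 0 z := by
    have hne := autFactor_ne_zero γ hz
    convert! (hasDerivAt_eichler F (coeffL k j) hz).sub
      ((hasDerivAt_eichler (slashM γ⁻¹ F) ((coeffL k j).comp (slashV γ))
        -- With `J = cz + d`: the factors `det/J²` from the chain rule and `(det/J)^{k-2}` from the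
        -- action on `(tx+y)^{k-2}` multiply to `det^{k-1}/J^k`, exactly the automorphy factor of
        -- `F`.
        (moebius_im_pos γ hz)).comp z (hasDerivAt_moebius γ hne)) using 1
    rw [LinearMap.comp_apply, slashV_linPow_moebius γ hne, map_smul,
      form_eq_slashM_inv_ofComplex hk F γ hz]
    -- Writing `k = n + 2` removes the truncated subtractions in the exponents.
    obtain ⟨n, rfl⟩ := Nat.exists_eq_add_of_le' hk
    simp only [Nat.add_sub_cancel, smul_eq_mul, div_pow, show n + 2 - 1 = n + 1 from rfl]
    field_simp
    ring
  have hval (τ : ℍ) : coeffV j (cocycleFun F γ τ) = D τ := by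
    rw [cocycleFun, coeffV_sub, W_eq_eichler, W_eq_eichler, coe_toGLR_smul]
    rfl
  rw [hval, hval]
  have hconv : IsPreconnected {z : ℂ | 0 < z.im} := (convex_halfSpace_im_gt 0).isPreconnected
  exact isOpen_upper.is_const_of_deriv_eq_zero hconv
    (fun z hz => (hD z hz).differentiableAt.differentiableWithinAt)
    (fun z hz => (hD z hz).deriv) τ.im_pos τ'.im_pos

theorem cocycleFun_mul (F : Mk k) (γ δ : G) (τ : ℍ) :
    cocycleFun F (γ * δ) τ =
      cocycleFun F δ τ + slashV δ (cocycleFun (slashM δ⁻¹ F) γ (toGLR δ • τ)) := by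
  simp only [cocycleFun, map_sub, ← slashV_mul, mul_inv_rev, slashM_mul, map_mul, mul_smul]
  abel

theorem cocycleFun_one (F : Mk k) (τ : ℍ) : cocycleFun F 1 τ = 0 := by
  rw [cocycleFun, inv_one, slashM_one, map_one, one_smul, slashV_one, sub_self]

/-- Splitting the integral needs both pieces to converge, hence the restriction to the upper half
plane. -/
theorem eichler_add (F F' : Mk k) {z : ℂ} (hz : 0 < z.im) :
    eichler k (F + F' : Mk k) z = eichler k F z + eichler k F' z := by
  refine vk_ext fun j hj => ?_
  have h : ∀ t, coeffV j (tildeF (F + F' : Mk k) t • linPow k t) =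
      coeffV j (tildeF F t • linPow k t) + coeffV j (tildeF F' t • linPow k t) := fun t => by
    rw [← coeffV_add, ← add_smul, tildeF, tildeF, tildeF, a0_add]
    congr 2
    show (F : ℍ → ℂ) _ + (F' : ℍ → ℂ) _ - _ = _
    ring
  simp only [eichler, coeffV_add, coeffV_neg, coeffV_smul, coeffV_rayInt _ _ hj, a0_add] at h ⊢
  simp only [h]
  have i1 := rayIntegrable_form F hz j hj
  have i2 := rayIntegrable_form F' hz j hj
  simp only [coeffV_smul] at i1 i2
  rw [integral_add i1 i2]
  ring

theorem eichler_smul (c : ℂ) (F : Mk k) (z : ℂ) :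
    eichler k (c • F : Mk k) z = c • eichler k F z := by
  refine vk_ext fun j hj => ?_
  have h : ∀ t, tildeF (c • F : Mk k) t = c * tildeF F t := fun t => by
    rw [tildeF, tildeF, a0_smul]
    show c * (F : ℍ → ℂ) _ - _ = _
    ring
  simp only [eichler, coeffV_add, coeffV_neg, coeffV_smul, coeffV_rayInt _ _ hj, a0_smul, h,
    mul_assoc, integral_const_mul]
  ring

theorem cocycleFun_add (F F' : Mk k) (γ : G) (τ : ℍ) :
    cocycleFun (F + F') γ τ = cocycleFun F γ τ + cocycleFun F' γ τ := by
  simp only [cocycleFun, W_eq_eichler, map_add, eichler_add _ _ τ.im_pos,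
    eichler_add _ _ (toGLR γ • τ).im_pos]
  abel

theorem cocycleFun_smul (c : ℂ) (F : Mk k) (γ : G) (τ : ℍ) :
    cocycleFun (c • F) γ τ = c • cocycleFun F γ τ := by
  simp only [cocycleFun, W_eq_eichler, map_smul, eichler_smul, smul_sub]

/-! ### Upper triangular matrices -/

section Borel

variable {γ : G} (h : γ.1 1 0 = 0)
include h

theorem autFactor_borel (z : ℂ) : autFactor γ z = (γ.1 1 1 : ℚ) := by simp [autFactor, h]

theorem detC_borel : detC γ = (γ.1 0 0 : ℚ) * (γ.1 1 1 : ℚ) := by simp [detC_eq, h]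

theorem moebius_borel (z : ℂ) :
    moebius γ z = ((γ.1 0 0 : ℚ) * z + (γ.1 0 1 : ℚ)) / (γ.1 1 1 : ℚ) := by
  simp [moebius, h]

theorem mul_pos_borel : 0 < γ.1 0 0 * γ.1 1 1 := by
  have h2 : (0 : ℚ) < (γ.1).det.val := γ.2
  rwa [det_eq, h, mul_zero, sub_zero] at h2

theorem div_pos_borel : (0 : ℝ) < ((γ.1 0 0 / γ.1 1 1 : ℚ) : ℝ) := by
  rw [Rat.cast_pos, div_eq_mul_inv]
  rcases mul_pos_iff.mp (mul_pos_borel h) with ⟨h1, h2⟩ | ⟨h1, h2⟩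
  · exact mul_pos h1 (inv_pos.mpr h2)
  · exact mul_pos_of_neg_of_neg h1 (inv_neg''.mpr h2)

theorem moebius_borel_add (z : ℂ) (u : ℝ) :
    moebius γ (z + Complex.I * u) =
      moebius γ z + Complex.I * ((((γ.1 0 0 / γ.1 1 1 : ℚ) : ℝ) * u : ℝ) : ℂ) := by
  rw [moebius_borel h, moebius_borel h]
  push_cast
  ring

/-- Upper triangular matrices scale imaginary parts by `a/d > 0`; this is why constant terms
transform like the forms themselves. -/
theorem tendsto_smul_borel : Tendsto (fun τ : ℍ => toGLR γ • τ) atImInfty atImInfty := by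
  rw [atImInfty, tendsto_comap_iff]
  refine (tendsto_comap.const_mul_atTop (div_pos_borel h)).congr fun τ => ?_
  show _ = (toGLR γ • τ).im
  have hm : (toGLR γ • τ).im = (moebius γ τ).im := by rw [← coe_im, coe_toGLR_smul]
  rw [hm]
  have := moebius_borel_add h (τ.re : ℂ) τ.im
  have e : (τ : ℂ) = (τ.re : ℂ) + Complex.I * (τ.im : ℂ) := by
    rw [mul_comm]; exact (Complex.re_add_im _).symm
  have h0 : (moebius γ (τ.re : ℂ)).im = 0 := by
    have : moebius γ (τ.re : ℂ) =
        ((((γ.1 0 0 : ℚ) * τ.re + (γ.1 0 1 : ℚ)) / (γ.1 1 1 : ℚ) : ℝ) : ℂ) := by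
      rw [moebius_borel h]; push_cast; rfl
    rw [this, Complex.ofReal_im]
  rw [e, this, add_I_mul_im, h0, zero_add]

theorem a0_borel (hk : 2 ≤ k) (F : Mk k) :
    a0 F = detC γ ^ (k - 1) / ((γ.1 1 1 : ℚ) : ℂ) ^ k * a0 (slashM γ⁻¹ F : Mk k) := by
  refine a0_eq_of_tendsto ((((tendsto_a0 (slashM γ⁻¹ F)).comp
    (tendsto_smul_borel h)).const_mul _).congr fun τ => ?_)
  rw [form_eq_slashM_inv hk F γ τ, autFactor_borel h]
  rfl

theorem tildeF_borel (hk : 2 ≤ k) (F : Mk k) {z : ℂ} (hz : 0 < z.im) :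
    tildeF F z = detC γ ^ (k - 1) / ((γ.1 1 1 : ℚ) : ℂ) ^ k *
      tildeF (slashM γ⁻¹ F : Mk k) (moebius γ z) := by
  rw [tildeF, tildeF, form_eq_slashM_inv_ofComplex hk F γ hz, a0_borel h hk F, autFactor_borel h]
  ring

/-- γ maps the vertical ray above `z` to the one above `γz`, with parameter multiplied by `a/d`; the
change of variables absorbs the automorphy factors. -/
theorem slashV_rayInt_borel (hk : 2 ≤ k) (F : Mk k) {z : ℂ} (hz : 0 < z.im) :
    slashV γ (rayInt (fun t => tildeF (slashM γ⁻¹ F : Mk k) t • linPow k t) (moebius γ z)) =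
      rayInt (fun t => tildeF F t • linPow k t) z := by
  have hd : ((γ.1 1 1 : ℚ) : ℂ) ≠ 0 := by
    simpa using (mul_ne_zero_iff.mp (mul_pos_borel h).ne').2
  rw [slashV_rayInt γ (rayIntegrable_form _ (moebius_im_pos γ hz))]
  refine vk_ext fun j hj => ?_
  rw [coeffV_rayInt _ _ hj, coeffV_rayInt _ _ hj]
  congr 1
  have := integral_comp_mul_left_Ioi' (fun u : ℝ => coeffV j (slashV γ
    (tildeF (slashM γ⁻¹ F : Mk k) (moebius γ z + Complex.I * u) •
      linPow k (moebius γ z + Complex.I * u)))) 0 (div_pos_borel h)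
  rw [mul_zero] at this
  rw [← this, ← integral_smul]
  refine setIntegral_congr_fun measurableSet_Ioi fun u (hu : 0 < u) => ?_
  have hzu : 0 < (z + Complex.I * u).im := by rw [add_I_mul_im]; positivity
  rw [← moebius_borel_add h, map_smul, slashV_linPow_moebius γ (autFactor_ne_zero γ hzu),
    tildeF_borel h hk F hzu, autFactor_borel h, detC_borel h]
  simp only [coeffV_smul, Complex.real_smul]
  obtain ⟨n, rfl⟩ := Nat.exists_eq_add_of_le' hk
  simp only [Nat.add_sub_cancel, show n + 2 - 1 = n + 1 from rfl]
  push_cast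
  field_simp
  ring

/-- The left side has zero derivative on all of ℂ, so it may be evaluated at `z = -b/a`, where `γz =
0` and the second integral is empty. -/
theorem linInt_borel (hk : 2 ≤ k) (F : Mk k) (z : ℂ) :
    a0 F • linInt k z - a0 (slashM γ⁻¹ F : Mk k) • slashV γ (linInt k (moebius γ z)) =
      a0 F • linInt k (((-(γ.1 0 1 / γ.1 0 0) : ℚ)) : ℂ) := by
  obtain ⟨ha, hd⟩ := mul_ne_zero_iff.mp (mul_pos_borel h).ne'
  have hd' : ((γ.1 1 1 : ℚ) : ℂ) ≠ 0 := by simpa using hd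
  have ha' : ((γ.1 0 0 : ℚ) : ℂ) ≠ 0 := by simpa using ha
  refine vk_ext fun j hj => ?_
  let D : ℂ → ℂ := fun z => a0 F * coeffL k j (linInt k z) -
    a0 (slashM γ⁻¹ F : Mk k) * ((coeffL k j).comp (slashV γ)) (linInt k (moebius γ z))
  have hD (z : ℂ) : HasDerivAt D 0 z := by
    have hne : autFactor γ z ≠ 0 := by rwa [autFactor_borel h]
    convert! ((hasDerivAt_linInt (coeffL k j) z).const_mul (a0 F)).sub
      (((hasDerivAt_linInt ((coeffL k j).comp (slashV γ)) (moebius γ z)).comp z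
        (hasDerivAt_moebius γ hne)).const_mul (a0 (slashM γ⁻¹ F : Mk k))) using 1
    rw [LinearMap.comp_apply, slashV_linPow_moebius γ hne, map_smul, a0_borel h hk F,
      autFactor_borel h]
    obtain ⟨n, rfl⟩ := Nat.exists_eq_add_of_le' hk
    simp only [Nat.add_sub_cancel, smul_eq_mul, div_pow, show n + 2 - 1 = n + 1 from rfl]
    field_simp
    ring
  have hc := is_const_of_deriv_eq_zero (fun z => (hD z).differentiableAt) (fun z => (hD z).deriv)
    z ((-(γ.1 0 1 / γ.1 0 0) : ℚ) : ℂ)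
  have h0 : moebius γ ((-(γ.1 0 1 / γ.1 0 0) : ℚ) : ℂ) = 0 := by
    rw [moebius_borel h]
    push_cast
    field_simp
    simp
  simp only [D, h0, linInt_zero, map_zero, mul_zero, sub_zero] at hc
  simpa only [coeffV_sub, coeffV_smul, coeffL_apply, LinearMap.comp_apply] using hc

theorem cocycleFun_borel (hk : 2 ≤ k) (F : Mk k) (τ : ℍ) :
    cocycleFun F γ τ = a0 F • linInt k (((-(γ.1 0 1 / γ.1 0 0) : ℚ)) : ℂ) := by
  rw [← linInt_borel h hk F τ, cocycleFun, W_eq_eichler, W_eq_eichler, coe_toGLR_smul, eichler,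
    eichler, map_add, map_neg, slashV_rayInt_borel h hk F τ.im_pos, map_smul]
  abel

end Borel

/-! ### Uniqueness of regularized values -/

/-- Infinite order of vanishing of `f - g` propagates over connected ℂ; analyticity at `s₁` turns
vanishing on a punctured neighbourhood into vanishing at the point. -/
theorem eq_of_meromorphicOn_of_eq {f g : ℂ → ℂ} (hf : MeromorphicOn f Set.univ)
    (hg : MeromorphicOn g Set.univ) {U : Set ℂ} (hU : IsOpen U) {s₀ s₁ : ℂ} (hs₀ : s₀ ∈ U)
    (hfg : Set.EqOn f g U) (hf₁ : AnalyticAt ℂ f s₁) (hg₁ : AnalyticAt ℂ g s₁) : f s₁ = g s₁ := by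
  have hm := hf.sub hg
  have h0 : meromorphicOrderAt (f - g) s₀ = ⊤ := by
    rw [meromorphicOrderAt_eq_top_iff]
    refine eventually_nhdsWithin_of_eventually_nhds ?_
    filter_upwards [hU.mem_nhds hs₀] with s hs
    rw [Pi.sub_apply, hfg hs, sub_self]
  have h1 : meromorphicOrderAt (f - g) s₁ = ⊤ := by
    by_contra h
    exact hm.meromorphicOrderAt_ne_top_of_isPreconnected isPreconnected_univ
      (Set.mem_univ s₁) (Set.mem_univ s₀) h h0
  rw [meromorphicOrderAt_eq_top_iff] at h1
  have hc : Tendsto (f - g) (𝓝[≠] s₁) (𝓝 ((f - g) s₁)) :=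
    (hf₁.sub hg₁).continuousAt.continuousWithinAt
  have := tendsto_nhds_unique (hc.congr' h1) tendsto_const_nhds
  exact sub_eq_zero.mp this

theorem IsRegularizedPeriod.unique {F : ℍ → ℂ} {v v' : Vk k} (h : IsRegularizedPeriod F v)
    (h' : IsRegularizedPeriod F v') : v = v' := by
  obtain ⟨R, hR, hm, rfl⟩ := h
  obtain ⟨R', hR', hm', rfl⟩ := h'
  refine vk_ext fun j hj => ?_
  refine eq_of_meromorphicOn_of_eq (hm j hj).1 (hm' j hj).1
    (isOpen_lt continuous_const Complex.continuous_re : IsOpen {s : ℂ | (k : ℝ) < s.re})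
    (s₀ := (k + 1 : ℕ)) (by simp) (fun s hs => ?_) (hm j hj).2 (hm' j hj).2
  show coeffV j (R s) = coeffV j (R' s)
  rw [(hR s (le_of_lt hs)).2, (hR' s (le_of_lt hs)).2]

/-! ### Mellin transforms along the imaginary axis -/

/-- The function `u ↦ F(i u) - a₀(F)`, restricted to `u ∈ S`. -/
def tail (F : ℍ → ℂ) (S : Set ℝ) (u : ℝ) : ℂ := S.indicator (fun u => tildeF F (Complex.I * u)) u

theorem continuousOn_axis (F : Mk k) :
    ContinuousOn (fun u : ℝ => tildeF F (Complex.I * u)) (Set.Ioi 0) :=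
  (rapidDecay_tildeF F).diff.continuousOn.comp (by fun_prop) fun u (hu : 0 < u) => by simpa using hu

section tail

variable (F : Mk k) {S : Set ℝ} (hS : MeasurableSet S) (hS1 : S ⊆ Set.Ici 1)

include hS1 in
theorem exists_bound_tail : ∃ c : ℝ, 0 < c ∧ ∃ C : ℝ, 0 ≤ C ∧ ∀ u : ℝ,
    ‖tail F S u‖ ≤ C * Real.exp (-c * u) := by
  obtain ⟨c, hc, C, hC, h⟩ := (rapidDecay_tildeF F).bound 0 1 one_pos
  refine ⟨c, hc, C, hC, fun u => ?_⟩
  by_cases hu : u ∈ S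
  · rw [tail, Set.indicator_of_mem hu]
    simpa using h (Complex.I * u) (by simp) (by simpa using hS1 hu)
  · rw [tail, Set.indicator_of_notMem hu, norm_zero]
    positivity

include hS hS1 in
theorem locallyIntegrableOn_tail : LocallyIntegrableOn (tail F S) (Set.Ioi 0) := by
  obtain ⟨c, hc, C, hC, h⟩ := exists_bound_tail F hS1
  have h1 : IntegrableOn (tail F S) (Set.Ioi 0) := by
    refine Integrable.mono' ((exp_neg_integrableOn_Ioi 0 hc).const_mul C) ?_ (ae_of_all _ h)
    exact (((continuousOn_axis F).aestronglyMeasurable measurableSet_Ioi).indicator hS)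
  exact h1.locallyIntegrableOn

include hS1 in
theorem tail_isBigO_atTop :
    ∃ c : ℝ, 0 < c ∧ tail F S =O[atTop] fun u => Real.exp (-c * u) := by
  obtain ⟨c, hc, C, hC, h⟩ := exists_bound_tail F hS1
  refine ⟨c, hc, Asymptotics.IsBigO.of_bound C (Eventually.of_forall fun u => ?_)⟩
  simpa using h u

include hS1 in
-- The tail vanishes near 0, so `b` is arbitrary; together with exponential decay this makes its
-- Mellin transform entire.
theorem tail_isBigO_zero (b : ℝ) : tail F S =O[𝓝[>] 0] (· ^ (-b) : ℝ → ℝ) := by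
  refine (Asymptotics.isBigO_zero _ _).congr' ?_ EventuallyEq.rfl
  refine eventually_nhdsWithin_of_eventually_nhds ?_
  filter_upwards [gt_mem_nhds (zero_lt_one' ℝ)] with u hu
  rw [tail, Set.indicator_of_notMem fun h => (not_le.mpr hu) (hS1 h)]

include hS hS1 in
theorem mellinConvergent_tail (s : ℂ) : MellinConvergent (tail F S) s := by
  obtain ⟨c, hc, h⟩ := tail_isBigO_atTop F hS1
  exact mellinConvergent_of_isBigO_rpow_exp hc (locallyIntegrableOn_tail F hS hS1) h
    (tail_isBigO_zero F hS1 (s.re - 1)) (by linarith)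

include hS hS1 in
theorem differentiable_mellin_tail : Differentiable ℂ (mellin (tail F S)) := fun s => by
  obtain ⟨c, hc, h⟩ := tail_isBigO_atTop F hS1
  exact mellin_differentiableAt_of_isBigO_rpow_exp hc (locallyIntegrableOn_tail F hS hS1) h
    (tail_isBigO_zero F hS1 (s.re - 1)) (by linarith)

end tail

/-- The substitution `u ↦ u + 1` moves the ray from `i` to the part `u > 1` of the axis. Allowing
`S` to vary by a null set serves both the open and the closed half-line. -/
theorem integral_ray_eq_mellin (F : Mk k) {S : Set ℝ} (hS : S =ᵐ[volume] Set.Ioi 1)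
    (hSm : MeasurableSet S) (hS0 : S ⊆ Set.Ioi 0) (j : ℕ) :
    ∫ u : ℝ in Set.Ioi 0, tildeF F (Complex.I + Complex.I * u) * (Complex.I + Complex.I * u) ^ j =
      Complex.I ^ j * mellin (tail F S) (j + 1) := by
  have e1 : mellin (tail F S) (j + 1) = ∫ u : ℝ in S, (u : ℂ) ^ j * tildeF F (Complex.I * u) := by
    rw [mellin]
    have (t : ℝ) : (t : ℂ) ^ ((j : ℂ) + 1 - 1) • tail F S t =
        S.indicator (fun u : ℝ => (u : ℂ) ^ j * tildeF F (Complex.I * u)) t := by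
      rw [add_sub_cancel_right, Complex.cpow_natCast, tail, smul_eq_mul, Set.indicator_mul_right]
    simp only [this]
    rw [setIntegral_indicator hSm, Set.inter_eq_right.mpr hS0]
  have e2 := (measurePreserving_add_right volume (1 : ℝ)).setIntegral_preimage_emb
    (measurableEmbedding_addRight 1)
    (fun u : ℝ => (u : ℂ) ^ j * tildeF F (Complex.I * u)) (Set.Ioi 1)
  rw [e1, setIntegral_congr_set hS, ← e2, ← integral_const_mul]
  have e3 : (fun x : ℝ => x + 1) ⁻¹' Set.Ioi 1 = Set.Ioi 0 := by ext; simp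
  rw [e3]
  refine integral_congr_ae (ae_of_all _ fun u => ?_)
  have e4 : Complex.I + Complex.I * u = Complex.I * ((u + 1 : ℝ) : ℂ) := by push_cast; ring
  simp only [e4, mul_pow]
  ring

/-- The matrix with rows `(0, 1)` and `(-1, 0)`. -/
def weyl : G := mkG 0 1 (-1) 0 (by norm_num)

theorem weyl_inv_smul : weyl⁻¹ • piInfty 0 = piZero := by
  rw [inv_smul_eq_iff]
  refine InfCusp.ext ?_ ?_
  · exact Eq.symm ((smul_coe weyl 0).trans (by simp [weyl, piInfty]))
  · exact Eq.symm ((smul_infty weyl).trans (by simp [weyl, piInfty]))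

theorem detC_weyl : detC weyl = 1 := by simp [detC_eq, weyl]

theorem autFactor_weyl (z : ℂ) : autFactor weyl z = -z := by simp [autFactor, weyl]

theorem moebius_weyl (z : ℂ) : moebius weyl z = -z⁻¹ := by
  simp [moebius, weyl, div_eq_mul_inv, inv_neg]

theorem tildeF_axis (hk : 2 ≤ k) (F : Mk k) {u : ℝ} (hu : 0 < u) :
    tildeF F (Complex.I * u) =
      Complex.I ^ k * ((u : ℂ) ^ (-(k : ℂ)) * tildeF (slashM weyl⁻¹ F : Mk k) (Complex.I * (u⁻¹ : ℝ)))
      + (Complex.I ^ k * a0 (slashM weyl⁻¹ F : Mk k) * (u : ℂ) ^ (-(k : ℂ)) - a0 F) := by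
  have hu' : (u : ℂ) ≠ 0 := by simpa using hu.ne'
  have hm : moebius weyl (Complex.I * u) = Complex.I * (u⁻¹ : ℝ) := by
    rw [moebius_weyl, mul_inv, Complex.inv_I]; push_cast; ring
  rw [tildeF, form_eq_slashM_inv_ofComplex hk F weyl (by simpa using hu), detC_weyl,
    autFactor_weyl, hm, tildeF, Complex.cpow_neg, Complex.cpow_natCast, one_pow]
  have : (1 : ℂ) / (-(Complex.I * u)) ^ k = Complex.I ^ k * ((u : ℂ) ^ k)⁻¹ := by
    rw [← neg_mul, mul_pow, one_div, mul_inv, ← inv_pow, inv_neg, Complex.inv_I, neg_neg]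
  rw [this]
  ring

/-- The Mellin transform of `F(i u) - a₀(F)`, continued to a meromorphic function. -/
def mellinCont (F : Mk k) (w : ℂ) : ℂ :=
  mellin (tail F (Set.Ioi 1)) w +
    Complex.I ^ k * mellin (tail (slashM weyl⁻¹ F : Mk k) (Set.Ici 1)) (k - w) +
    (Complex.I ^ k * a0 (slashM weyl⁻¹ F : Mk k) * (1 / (w - k)) - a0 F * (1 / w))

/-- Riemann's method: split at `u = 1` and use the transformation under `u ↦ 1/u` on the lower part.
The power `u^{-k}` integrated over `(0, 1]` forces `Re w > k`. -/
theorem hasMellin_axis (hk : 2 ≤ k) (F : Mk k) {w : ℂ} (hw : (k : ℝ) < w.re) :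
    HasMellin (fun u : ℝ => tildeF F (Complex.I * u)) w (mellinCont F w) := by
  have hw0 : 0 < w.re := lt_of_le_of_lt (Nat.cast_nonneg k) hw
  set Φ := slashM weyl⁻¹ F with hΦ
  have m1 := mellinConvergent_tail F measurableSet_Ioi (Set.Ioi_subset_Ici_self (a := (1 : ℝ))) w
  have m2 : HasMellin (fun u : ℝ => (u : ℂ) ^ (-(k : ℂ)) • tail Φ (Set.Ici 1) u⁻¹) w
      (mellin (tail Φ (Set.Ici 1)) (k - w)) := by
    have hc := mellinConvergent_tail Φ measurableSet_Ici (le_refl (Set.Ici (1 : ℝ))) (k - w)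
    constructor
    · rw [MellinConvergent.cpow_smul]
      have := (MellinConvergent.comp_rpow (f := tail Φ (Set.Ici 1)) (s := w + -(k : ℂ))
        (a := -1) (by norm_num)).mpr (by convert! hc using 1; push_cast; ring)
      simpa only [Real.rpow_neg_one] using this
    · rw [mellin_cpow_smul, mellin_comp_inv]
      congr 1; ring
  have m3 := hasMellin_cpow_Ioc (-(k : ℂ)) (s := w) (by simpa using hw)
  have m4 := hasMellin_one_Ioc hw0
  have m2' := hasMellin_const_smul m2.1 (Complex.I ^ k)
  have m3' := hasMellin_const_smul m3.1 (Complex.I ^ k * a0 Φ)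
  have m4' := hasMellin_const_smul m4.1 (a0 (F : ℍ → ℂ))
  have m34 := hasMellin_sub m3'.1 m4'.1
  have m12 := hasMellin_add m1 m2'.1
  have m := hasMellin_add m12.1 m34.1
  rw [m12.2, m34.2, m2'.2, m3'.2, m4'.2, m2.2, m3.2, m4.2] at m
  -- With `F` cut to `(1, ∞)` and `Φ` to `[1, ∞)`, the point `u = 1` is covered exactly once, so the
  -- identity is pointwise.
  have hEq : Set.EqOn (fun u : ℝ => tildeF F (Complex.I * u)) (fun u : ℝ =>
      tail F (Set.Ioi 1) u + Complex.I ^ k • ((u : ℂ) ^ (-(k : ℂ)) • tail Φ (Set.Ici 1) u⁻¹) +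
      ((Complex.I ^ k * a0 Φ) • (Set.Ioc (0 : ℝ) 1).indicator (fun t : ℝ => (t : ℂ) ^ (-(k : ℂ))) u -
        a0 F • (Set.Ioc (0 : ℝ) 1).indicator (fun _ => 1) u)) (Set.Ioi 0) := by
    intro u (hu : 0 < u)
    simp only [tail, Set.indicator_apply, Set.mem_Ioi, Set.mem_Ici, Set.mem_Ioc, hu, true_and,
      one_le_inv₀ hu]
    rcases le_or_gt u 1 with h | h
    · simp only [h, not_lt.mpr h, if_true, if_false]
      rw [tildeF_axis hk F hu, ← hΦ]
      simp
    · simp [h, not_le.mpr h]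
  have hEq' (u : ℝ) (hu : u ∈ Set.Ioi (0 : ℝ)) := congrArg (fun x => (u : ℂ) ^ (w - 1) • x) (hEq hu)
  refine ⟨?_, ?_⟩
  · exact (integrableOn_congr_fun hEq' measurableSet_Ioi).mpr m.1
  · refine (setIntegral_congr_fun measurableSet_Ioi hEq').trans (m.2.trans ?_)
    rw [mellinCont, ← hΦ]
    simp only [smul_eq_mul, sub_eq_add_neg]

theorem analyticAt_mellinCont (F : Mk k) {w : ℂ} (hw : w ≠ 0) (hw' : w ≠ k) :
    AnalyticAt ℂ (mellinCont F) w := by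
  have h1 := (differentiable_mellin_tail F measurableSet_Ioi
    (Set.Ioi_subset_Ici_self (a := (1 : ℝ)))).analyticAt w
  have h2 := ((differentiable_mellin_tail (slashM weyl⁻¹ F) measurableSet_Ici
    (le_refl (Set.Ici (1 : ℝ)))).comp ((differentiable_const (k : ℂ)).sub
      differentiable_id)).analyticAt w
  have h3 : AnalyticAt ℂ (fun w : ℂ => 1 / (w - k)) w :=
    analyticAt_const.div (analyticAt_id.sub analyticAt_const) (sub_ne_zero.mpr hw')
  have h4 : AnalyticAt ℂ (fun w : ℂ => 1 / w) w := analyticAt_const.div analyticAt_id hw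
  exact (h1.add (analyticAt_const.mul h2)).add
    ((analyticAt_const.mul h3).sub (analyticAt_const.mul h4))

theorem meromorphicAt_mellinCont (F : Mk k) (w : ℂ) : MeromorphicAt (mellinCont F) w := by
  have h1 := ((differentiable_mellin_tail F measurableSet_Ioi
    (Set.Ioi_subset_Ici_self (a := (1 : ℝ)))).analyticAt w).meromorphicAt
  have h2 := (((differentiable_mellin_tail (slashM weyl⁻¹ F) measurableSet_Ici
    (le_refl (Set.Ici (1 : ℝ)))).comp ((differentiable_const (k : ℂ)).sub
      differentiable_id)).analyticAt w).meromorphicAt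
  have h3 : MeromorphicAt (fun w : ℂ => 1 / (w - k)) w :=
    (MeromorphicAt.const 1 w).div ((MeromorphicAt.id w).sub (MeromorphicAt.const _ w))
  have h4 : MeromorphicAt (fun w : ℂ => 1 / w) w :=
    (MeromorphicAt.const 1 w).div (MeromorphicAt.id w)
  exact (h1.add ((MeromorphicAt.const _ w).mul h2)).add
    (((MeromorphicAt.const _ w).mul h3).sub ((MeromorphicAt.const _ w).mul h4))

/-! ### The period along the imaginary axis -/

theorem coe_monoV {j : ℕ} (hj : j ≤ k - 2) :
    (monoV k j : MvPolynomial (Fin 2) ℂ) = MvPolynomial.monomial (expo k j) 1 := by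
  have hd : (expo k j).degree = k - 2 := by
    rw [expo, map_add, Finsupp.degree_single, Finsupp.degree_single]; omega
  have : monoV k j = (⟨MvPolynomial.monomial (expo k j) 1,
      MvPolynomial.isHomogeneous_monomial _ hd⟩ : Vk k) := by
    refine vk_ext fun i hi => ?_
    rw [monoV, coeffV_ofCoeffs _ hi]
    show _ = MvPolynomial.coeff _ (MvPolynomial.monomial _ _)
    rw [MvPolynomial.coeff_monomial, Pi.single_apply]
    simp only [expo_inj, eq_comm]
  rw [this]

/-- The action substitutes `x ↦ y`, `y ↦ -x`, which reverses the exponents. -/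
theorem coeffV_slashV_weyl (P : Vk k) {j : ℕ} (hj : j ≤ k - 2) :
    coeffV j (slashV weyl P) = (-1) ^ j * coeffV (k - 2 - j) P := by
  have key (m : ℕ) (hm : m ≤ k - 2) :
      coeffV j (slashV weyl (monoV k m)) = if m = k - 2 - j then (-1) ^ j else 0 := by
    show MvPolynomial.coeff (expo k j) (slashV weyl (monoV k m) : MvPolynomial (Fin 2) ℂ) = _
    have e : (slashV weyl (monoV k m) : MvPolynomial (Fin 2) ℂ) =
        MvPolynomial.monomial (expo k (k - 2 - m)) ((-1) ^ (k - 2 - m)) := by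
      rw [coe_slashV, coe_monoV hm, MvPolynomial.aeval_monomial, MvPolynomial.monomial_eq,
        Finsupp.prod_fintype _ _ (by simp), Finsupp.prod_fintype _ _ (by simp), Fin.prod_univ_two,
        Fin.prod_univ_two, expo_zero, expo_zero, expo_one, expo_one, Nat.sub_sub_self hm]
      simp [substForms, weyl, neg_pow (MvPolynomial.X 0 : MvPolynomial (Fin 2) ℂ)]
      ring
    rw [e, MvPolynomial.coeff_monomial]
    simp only [expo_inj]
    by_cases h : m = k - 2 - j
    · rw [if_pos h, if_pos (by omega), h, Nat.sub_sub_self hj]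
    · rw [if_neg h, if_neg (by omega)]
  have h := map_eq_sum ((coeffL k j).comp (slashV weyl)) P
  simp only [LinearMap.comp_apply, coeffL_apply] at h
  rw [h, Finset.sum_eq_single (k - 2 - j)]
  · rw [key _ (by omega), if_pos rfl, mul_comm]
  · intro m hm hne
    rw [key m (Nat.lt_succ_iff.mp (Finset.mem_range.mp hm)), if_neg hne, mul_zero]
  · intro h
    exact absurd (Finset.mem_range.mpr (by omega)) h

theorem coeffV_eichler_I (F : Mk k) {S : Set ℝ} (hS : S =ᵐ[volume] Set.Ioi 1)
    (hSm : MeasurableSet S) (hS0 : S ⊆ Set.Ioi 0) {j : ℕ} (hj : j ≤ k - 2) :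
    coeffV j (eichler k F Complex.I) = -((k - 2).choose j : ℂ) * Complex.I ^ (j + 1) *
      (mellin (tail F S) (j + 1) - a0 F * (1 / (j + 1))) := by
  rw [eichler, coeffV_add, coeffV_neg, coeffV_smul, coeffV_rayInt _ _ hj, coeffV_linInt _ hj]
  simp only [coeffV_tildeF_smul_linPow _ _ hj]
  rw [integral_const_mul, integral_ray_eq_mellin F hS hSm hS0]
  ring

/-- At the fixed point `τ = i` the two Eichler integrals supply the two tails of `mellinCont`, and
their polynomial integrals supply its two polar terms; the reversal of exponents is `w ↦ k - w` at
`w = j + 1`. -/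
theorem coeffV_cocycleFun_weyl (hk : 2 ≤ k) (F : Mk k) (τ : ℍ) {j : ℕ} (hj : j ≤ k - 2) :
    coeffV j (cocycleFun F weyl τ) =
      -((k - 2).choose j : ℂ) * Complex.I ^ (j + 1) * mellinCont F (j + 1) := by
  have hI : moebius weyl Complex.I = Complex.I := by
    rw [moebius_weyl, Complex.inv_I, neg_neg]
  rw [cocycleFun_const hk F weyl τ UpperHalfPlane.I, cocycleFun, W_eq_eichler, W_eq_eichler,
    coe_toGLR_smul, UpperHalfPlane.coe_I, hI, coeffV_sub, coeffV_slashV_weyl _ hj,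
    coeffV_eichler_I F (EventuallyEq.rfl) measurableSet_Ioi
      (Set.Ioi_subset_Ioi zero_le_one) hj,
    coeffV_eichler_I (slashM weyl⁻¹ F) Ioi_ae_eq_Ici.symm measurableSet_Ici
      (Set.Ici_subset_Ioi.mpr one_pos) (Nat.sub_le _ _),
    Nat.choose_symm hj, mellinCont]
  obtain ⟨m, hm⟩ := Nat.exists_eq_add_of_le hj
  have hkm : (k : ℂ) = j + m + 2 := by
    have : k = j + m + 2 := by omega
    rw [this]; push_cast; ring
  have e1 : k - 2 - j = m := by omega
  have e2 : k = j + m + 2 := by omega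
  have e3 : (k : ℂ) - (j + 1) = m + 1 := by rw [hkm]; ring
  have e4 : (j : ℂ) + 1 - k = -(m + 1) := by rw [hkm]; ring
  have hI2 : Complex.I ^ (j + 1) * Complex.I ^ k = -((-1) ^ j * Complex.I ^ (m + 1)) := by
    have : Complex.I ^ (j + 1) * Complex.I ^ k = (Complex.I ^ 2) ^ (j + 1) * Complex.I ^ (m + 1) := by
      rw [← pow_mul, ← pow_add, ← pow_add]; congr 1; omega
    rw [this, Complex.I_sq]; ring
  rw [e1, e3, e4, one_div_neg_eq_neg_one_div]
  linear_combination (-((k - 2).choose j : ℂ)) * (-1) * (mellin (tail (slashM weyl⁻¹ F : Mk k)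
    (Set.Ici 1)) (m + 1) - a0 (slashM weyl⁻¹ F : Mk k) * (1 / (m + 1))) * hI2

theorem isRegularizedPeriod_weyl (hk : 2 ≤ k) (F : Mk k) (τ : ℍ) :
    IsRegularizedPeriod (F : ℍ → ℂ) (cocycleFun F weyl τ) := by
  let R : ℂ → Vk k := fun s => ofCoeffs k fun j =>
    -((k - 2).choose j : ℂ) * Complex.I ^ (j + 1) * mellinCont F (s + (j + 1))
  have hR (s : ℂ) (j : ℕ) (hj : j ≤ k - 2) : coeffV j (R s) =
      -((k - 2).choose j : ℂ) * Complex.I ^ (j + 1) * mellinCont F (s + (j + 1)) :=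
    coeffV_ofCoeffs _ hj
  have hint (s : ℂ) (j : ℕ) (hj : j ≤ k - 2) : Set.EqOn (fun u : ℝ => coeffV j
      ((tildeF (F : ℍ → ℂ) (0 + Complex.I * u) * (-Complex.I * (0 + Complex.I * u)) ^ s) •
        linPow k (0 + Complex.I * u)))
      (fun u : ℝ => ((k - 2).choose j : ℂ) * Complex.I ^ j *
        ((u : ℂ) ^ (s + (j + 1) - 1) • tildeF (F : ℍ → ℂ) (Complex.I * u))) (Set.Ioi 0) := by
    intro u (hu : 0 < u)
    have hu' : (u : ℂ) ≠ 0 := by simpa using hu.ne'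
    have e1 : -Complex.I * (0 + Complex.I * u) = u := by
      rw [zero_add, ← mul_assoc, neg_mul, Complex.I_mul_I, neg_neg, one_mul]
    have e2 : s + ((j : ℂ) + 1) - 1 = s + j := by ring
    simp only
    rw [e1, coeffV_smul, coeffV_linPow _ hj, zero_add, e2, Complex.cpow_add _ _ hu',
      Complex.cpow_natCast, mul_pow, smul_eq_mul]
    ring
  have hmel (s : ℂ) (hs : (k : ℝ) ≤ s.re) (j : ℕ) := hasMellin_axis hk F (w := s + (j + 1)) (by
    -- The shift by `j + 1 ≥ 1` makes the strict inequality hold even on the line `Re s = k`.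
    have : (s + ((j : ℂ) + 1)).re = s.re + (j + 1) := by simp
    rw [this]
    have : (0 : ℝ) ≤ j := Nat.cast_nonneg j
    linarith)
  refine ⟨R, fun s hs => ⟨fun j hj => ?_, vk_ext fun j hj => ?_⟩, fun j hj => ⟨?_, ?_⟩, ?_⟩
  · exact (integrableOn_congr_fun (hint s j hj) measurableSet_Ioi).mpr ((hmel s hs j).1.const_mul _)
  · rw [hR s j hj, coeffV_neg, coeffV_rayInt _ _ hj,
      setIntegral_congr_fun measurableSet_Ioi (hint s j hj), integral_const_mul]
    have := (hmel s hs j).2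
    rw [mellin] at this
    rw [this]
    ring
  · intro s _
    simp only [hR _ j hj]
    refine (MeromorphicAt.const _ s).mul ?_
    exact (meromorphicAt_comp_add_const_iff_meromorphicAt (c := (j : ℂ) + 1)).mpr
      (meromorphicAt_mellinCont F _)
  · simp only [hR _ j hj]
    refine analyticAt_const.mul ?_
    refine AnalyticAt.fun_comp (g := mellinCont F) (f := fun s : ℂ => s + ((j : ℂ) + 1)) ?_
      (analyticAt_id.add analyticAt_const)
    rw [zero_add]
    -- Here `0 < j + 1 ≤ k - 1 < k`, so neither pole is met at `s = 0`.
    refine analyticAt_mellinCont F (Nat.cast_add_one_ne_zero j) ?_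
    intro h
    have : j + 1 = k := by exact_mod_cast h
    omega
  · refine vk_ext fun j hj => ?_
    rw [hR 0 j hj, coeffV_cocycleFun_weyl hk F τ hj, zero_add]

/-! ### The period homomorphism -/

/-- The matrix `γ` with `γ⁻¹ π_∞(0) = T`. -/
def toCusp (T : InfCusp) : G := (exists_inv_smul_piInfty T).choose

theorem toCusp_spec (T : InfCusp) : (toCusp T)⁻¹ • piInfty 0 = T :=
  (exists_inv_smul_piInfty T).choose_spec

theorem entries_of_stabilizer {σ : G} (h : σ • piInfty 0 = piInfty 0) :
    σ.1 1 0 = 0 ∧ σ.1 0 1 = 0 := by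
  have h1 : σ • (OnePoint.infty : OnePoint ℚ) = OnePoint.infty := congrArg InfCusp.base h
  have h2 : σ • ((0 : ℚ) : OnePoint ℚ) = ((0 : ℚ) : OnePoint ℚ) := congrArg InfCusp.dir h
  have h3 : σ.1 1 0 = 0 := OnePoint.smul_infty_eq_self_iff.mp h1
  refine ⟨h3, ?_⟩
  have h4 := (mul_ne_zero_iff.mp (mul_pos_borel h3).ne').2
  rw [smul_coe, h3] at h2
  simpa [h4] using h2

theorem cocycleFun_stabilizer (hk : 2 ≤ k) (F : Mk k) {σ : G}
    (h : σ • piInfty 0 = piInfty 0) (τ : ℍ) : cocycleFun F σ τ = 0 := by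
  obtain ⟨h1, h2⟩ := entries_of_stabilizer h
  rw [cocycleFun_borel h1 hk, h2]
  simp [linInt_zero]

/-- `γδ⁻¹` fixes `π_∞(0)`, so its cocycle vanishes for every form, in particular for the twisted
form `F|δ⁻¹` in the cocycle relation. -/
theorem cocycleFun_eq_of_smul_eq (hk : 2 ≤ k) (F : Mk k) {γ δ : G}
    (h : γ⁻¹ • piInfty 0 = δ⁻¹ • piInfty 0) (τ τ' : ℍ) :
    cocycleFun F γ τ = cocycleFun F δ τ' := by
  have h1 : (γ * δ⁻¹) • piInfty 0 = piInfty 0 := by rw [mul_smul, ← h, smul_inv_smul]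
  have h2 := cocycleFun_mul F (γ * δ⁻¹) δ τ
  rw [inv_mul_cancel_right, cocycleFun_stabilizer hk _ h1, map_zero, add_zero] at h2
  rw [h2, cocycleFun_const hk F δ τ τ']

/-- The period homomorphism `M_k → Hom(Ξ₀, V_k(ℂ))`. -/
def periodHom (k : ℕ) : Mk k →ₗ[ℂ] (Xi0 →+ Vk k) where
  toFun F := homOfFun fun T => cocycleFun F (toCusp T) UpperHalfPlane.I
  map_add' F F' := hom_ext_of_brk (piInfty 0) fun T => by
    simp only [AddMonoidHom.add_apply, homOfFun_brk, cocycleFun_add]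
    abel
  map_smul' c F := hom_ext_of_brk (piInfty 0) fun T => by
    show _ = c • homOfFun (fun T => cocycleFun F (toCusp T) UpperHalfPlane.I) (brk (piInfty 0) T)
    simp only [homOfFun_brk, cocycleFun_smul, smul_sub]

theorem periodHom_apply (F : Mk k) :
    periodHom k F = homOfFun fun T => cocycleFun F (toCusp T) UpperHalfPlane.I := rfl

theorem periodHom_brk (hk : 2 ≤ k) (F : Mk k) (γ : G) (τ : ℍ) :
    periodHom k F (brk (piInfty 0) (γ⁻¹ • piInfty 0)) = cocycleFun F γ τ := by
  rw [periodHom_apply, homOfFun_brk,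
    cocycleFun_eq_of_smul_eq hk F (toCusp_spec (γ⁻¹ • piInfty 0)) _ τ,
    cocycleFun_eq_of_smul_eq hk F (γ := toCusp (piInfty 0)) (δ := 1)
      (by rw [toCusp_spec, inv_one, one_smul]) _ τ, cocycleFun_one, sub_zero]

theorem periodHom_equivariant (hk : 2 ≤ k) : IsEquivariant (periodHom k).toAddMonoidHom := by
  intro δ F D
  have key : periodHom k (slashM δ F) =
      ((slashV δ).toAddMonoidHom.comp (periodHom k F)).comp
        (DistribSMul.toAddMonoidHom Xi0 δ) := by
    refine hom_ext_of_brk (piInfty 0) fun T => ?_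
    obtain ⟨γ, rfl⟩ := exists_inv_smul_piInfty T
    show _ = slashV δ (periodHom k F (δ • brk (piInfty 0) (γ⁻¹ • piInfty 0)))
    have e1 : δ • γ⁻¹ • piInfty 0 = (γ * δ⁻¹)⁻¹ • piInfty 0 := by
      rw [mul_inv_rev, inv_inv, mul_smul]
    have e2 : δ • piInfty 0 = (δ⁻¹)⁻¹ • piInfty 0 := by rw [inv_inv]
    -- Rebasing at `π_∞(0)` expresses the translated symbol through cocycle values at `γδ⁻¹` and
    -- `δ⁻¹`; their difference is the twisted term of the cocycle relation.
    have e3 : brk ((δ⁻¹)⁻¹ • piInfty 0) ((γ * δ⁻¹)⁻¹ • piInfty 0) =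
        brk (piInfty 0) ((γ * δ⁻¹)⁻¹ • piInfty 0) - brk (piInfty 0) ((δ⁻¹)⁻¹ • piInfty 0) :=
      eq_sub_of_add_eq' (brk_add_brk _ _ _)
    rw [smul_brk, e1, e2, e3, map_sub, periodHom_brk hk F _ UpperHalfPlane.I,
      periodHom_brk hk F _ UpperHalfPlane.I, cocycleFun_mul, add_sub_cancel_left, ← slashV_mul,
      inv_mul_cancel, slashV_one, inv_inv, periodHom_brk hk]
  exact DFunLike.congr_fun key D

theorem inv_smul_piInfty_translation (r : ℚ) :
    (mkG 1 (-r) 0 1 (by norm_num))⁻¹ • piInfty 0 = piInfty r := by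
  rw [inv_smul_eq_iff]
  refine InfCusp.ext ?_ ?_
  · exact Eq.symm ((smul_infty _).trans (by simp [piInfty]))
  · exact Eq.symm ((smul_coe _ r).trans (by simp [piInfty]))

theorem periodHom_hasPeriodValues (hk : 2 ≤ k) :
    HasPeriodValues (periodHom k).toAddMonoidHom := by
  intro F
  constructor
  · have := periodHom_brk hk F weyl UpperHalfPlane.I
    rw [weyl_inv_smul] at this
    show IsRegularizedPeriod _ (periodHom k F symInftyZero)
    rw [symInftyZero, this]
    exact isRegularizedPeriod_weyl hk F _
  · intro r
    have := periodHom_brk hk F (mkG 1 (-r) 0 1 (by norm_num)) UpperHalfPlane.I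
    rw [inv_smul_piInfty_translation, cocycleFun_borel (by simp) hk] at this
    simpa [symInf] using this

theorem eq_periodHom_of_hasCocycleValues (hk : 2 ≤ k) {P : Mk k →+ (Xi0 →+ Vk k)}
    (hP : HasCocycleValues P) : P = (periodHom k).toAddMonoidHom := by
  ext1 F
  refine hom_ext_of_brk (piInfty 0) fun T => ?_
  obtain ⟨γ, rfl⟩ := exists_inv_smul_piInfty T
  rw [hP F γ UpperHalfPlane.I]
  exact (periodHom_brk hk F γ _).symm

theorem slashV_injective (γ : G) : Function.Injective (slashV (k := k) γ) :=
  Function.LeftInverse.injective (g := slashV γ⁻¹) fun P => by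
    rw [← slashV_mul, mul_inv_cancel, slashV_one]

theorem eq_of_hasPeriodValues {P P' : Mk k →+ (Xi0 →+ Vk k)}
    (hP : IsEquivariant P) (hP' : IsEquivariant P') (hv : HasPeriodValues P)
    (hv' : HasPeriodValues P') : P = P' := by
  ext1 F
  refine hom_ext_of_brk (piInfty 0) fun T => ?_
  -- The relation must quantify over all forms: moving a symbol by γ replaces `F` by `F|γ`.
  refine rel_of_edges (R := fun A B => ∀ F, P F (brk A B) = P' F (brk A B))
    (fun A B C h1 h2 F => ?_) (fun γ A B h F => ?_) (fun F => ?_) (fun s F => ?_) T F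
  · rw [← brk_add_brk A B C, map_add, map_add, h1 F, h2 F]
  · refine slashV_injective γ ?_
    rw [← smul_brk, ← hP, ← hP', h]
  · exact (hv F).1.unique (hv' F).1
  · exact ((hv F).2 s).trans ((hv' F).2 s).symm

end

end PeriodHom

theorem mainTheorem4 :
    -- equivariant homomorphisms on `Ξ₀` attached to cocycles vanishing on stabilizers
    (∀ (V : Type*) [AddCommGroup V] [Module ℚ V] [DistribMulAction PeriodHom.Gᵐᵒᵖ V]
      (H : Subgroup PeriodHom.G) (D : Set PeriodHom.InfCusp) (c : H → V),
      PeriodHom.IsRepSystem H D → PeriodHom.IsCocycle H c →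
      (∀ Z ∈ D, ∀ γ ∈ MulAction.stabilizer H Z, c γ = 0) →
      ∃ Ψ : PeriodHom.Xi0 →+ V,
        (PeriodHom.IsHInvariant H Ψ ∧
          ∀ (γ : H), ∀ Z ∈ D, Ψ (PeriodHom.brk Z (γ⁻¹ • Z)) = c γ) ∧
        (MulAction.IsPretransitive H PeriodHom.InfCusp →
          ∀ Ψ' : PeriodHom.Xi0 →+ V,
            PeriodHom.IsHInvariant H Ψ' →
            (∀ (γ : H), ∀ Z ∈ D, Ψ' (PeriodHom.brk Z (γ⁻¹ • Z)) = c γ) → Ψ' = Ψ)) ∧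
    -- the period homomorphism
    ∀ k : ℕ, 2 ≤ k →
      (∀ (F : PeriodHom.Mk k) (τ : UpperHalfPlane),
        PeriodHom.RayIntegrable
          (fun t => PeriodHom.tildeF (F : UpperHalfPlane → ℂ) t • PeriodHom.linPow k t) τ) ∧
      ∃ Per : PeriodHom.Mk k →ₗ[ℂ] (PeriodHom.Xi0 →+ PeriodHom.Vk k),
        PeriodHom.IsEquivariant Per.toAddMonoidHom ∧
        PeriodHom.HasCocycleValues Per.toAddMonoidHom ∧
        PeriodHom.HasPeriodValues Per.toAddMonoidHom ∧
        (∀ P : PeriodHom.Mk k →+ (PeriodHom.Xi0 →+ PeriodHom.Vk k),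
          PeriodHom.IsEquivariant P → PeriodHom.HasCocycleValues P →
            P = Per.toAddMonoidHom) ∧
        (∀ P : PeriodHom.Mk k →+ (PeriodHom.Xi0 →+ PeriodHom.Vk k),
          PeriodHom.IsEquivariant P → PeriodHom.HasPeriodValues P →
            P = Per.toAddMonoidHom) := by
  refine ⟨fun V _ _ _ H D c hD hc h0 => ?_, fun k hk => ⟨fun F τ =>
    PeriodHom.rayIntegrable_form F τ.im_pos, PeriodHom.periodHom k,
    PeriodHom.periodHom_equivariant hk, PeriodHom.periodHom_brk hk,
    PeriodHom.periodHom_hasPeriodValues hk,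
    fun P _ hP => PeriodHom.eq_periodHom_of_hasCocycleValues hk hP,
    fun P hP hv => PeriodHom.eq_of_hasPeriodValues hP (PeriodHom.periodHom_equivariant hk) hv
      (PeriodHom.periodHom_hasPeriodValues hk)⟩⟩
  obtain ⟨Ψ, hΨ, hv⟩ := PeriodHom.exists_hom_of_cocycle hD hc h0
  exact ⟨Ψ, ⟨hΨ, hv⟩, fun _ Ψ' _ hv' => PeriodHom.hom_unique_of_transitive hD hv hv'⟩
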